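/- Let $m\ge 0$ and let $f:\mathbb{R}\times\mathbb{R}^m\times(0,\infty)\to\mathbb{R}^m$, $(\tau,x,a)\mapsto f(\tau,x,a)$, be such that for every $a>0$ the map $f(\cdot,\cdot,a)$ is continuous in $\tau$ and Lipschitz in $x$ on every ball, with a Lipschitz constant that does not depend on $\tau$ (it may depend on $a$ and on the ball). The model-free extremum seeking control (ESC) system with parameters $a,\omega>0$ is $\dot x=f(\omega t,x,a)$. Suppose that its average $$\bar f(x,a)=\lim_{T\to\infty}\frac1T\int_{s}^{s+T}f(\tau,x,a)\,d\tau\qquad(x\in\mathbb{R}^m,\ a>0)$$ exists, uniformly in $s\in\mathbb{R}$ (for $s=0$ this is the usual average over $[0,T]$). The average system is $\dot x=\bar f(x,a)$. Suppose that the model-based vector field $h(z)=\lim_{a\to0^+}\bar f(z,a)$ exists, uniformly for $z$ in compact sets; the model-based system is $\dot z=h(z)$. Suppose that the model-based system is globally asymptotically stable at the origin: all its solutions exist for all future times, the origin is stable (for every $\varepsilon>0$ there is $\delta>0$ such that $\|z(0)\|<\delta$ implies $\|z(t)\|<\varepsilon$ for all $t\ge0$), and $z(t)\to0$ as $t\to\infty$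 for every solution. Then 1. the average system is semiglobally practically asymptotically stable to the origin with respect to the small parameter $a$, and 2. the model-free system is semiglobally practically uniformly asymptotically stable to the origin with respect to the small parameter vector $(a,\omega^{-1})$. Here, for a system $\dot x=F_\varepsilon(t,x)$ with parameter vector $\varepsilon=(\varepsilon_1,\dots,\varepsilon_k)$, say that a property holds *for small $\varepsilon$* if there is $\varepsilon_1^*>0$ such that for all $\varepsilon_1\in(0,\varepsilon_1^*)$ there is $\varepsilon_2^*>0$ such that for all $\varepsilon_2\in(0,\varepsilon_2^*)$, and so on up to $\varepsilon_k$, the property holds. Say that $B_\varepsilon(c_1,c_2,T)$ holds if, for every initial time $t_0\in\mathbb{R}$, every solution with $\|x(t_0)\|<c_1$ exists on $[t_0,\infty)$ and satisfies $\|x(t)\|<c_2$ for all $t\ge t_0+T$. The system is semiglobally practically uniformly asymptotically stable to the origin with respect to $(\varepsilon_1,\dots,\varepsilon_k)$ if it is * practically stable: for every $c_2>0$ there is $c_1>0$ such that $B_\varepsilon(c_1,c_2,0)$ holds for small $\varepsilon$; * practically bounded: for every $c_1>0$ there is $c_2>0$ such that $B_\varepsilon(c_1,c_2,0)$ holds for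 small $\varepsilon$; * semiglobally practically uniformly attractive: for every $\delta>0$, all $c_1\in(0,\delta)$ and $c_2>0$, there is $T\ge0$ such that $B_\varepsilon(c_1,c_2,T)$ holds for small $\varepsilon$. For autonomous systems the word "uniformly" is dropped. -/

import Mathlib

open Filter Topology Set

/-- `x` solves `ẋ = F(t, x)` on the time set `I` (an interval; one-sided derivative at an
end point that belongs to `I`). -/
def IsSolutionOn {m : ℕ} (F : ℝ → EuclideanSpace ℝ (Fin m) → EuclideanSpace ℝ (Fin m))
    (x : ℝ → EuclideanSpace ℝ (Fin m)) (I : Set ℝ) : Prop :=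
  ∀ t ∈ I, HasDerivWithinAt x (F t (x t)) I t

/-- Solutions of `ẋ = F(t, x)` that start at `(t₀, x₀)` exist for all future times: there is one
on `[t₀, ∞)`, and none has a finite escape time, i.e. each solution on some `[t₀, t₁)` is the
restriction of a solution on `[t₀, ∞)`. -/
def ForwardCompleteFrom {m : ℕ}
    (F : ℝ → EuclideanSpace ℝ (Fin m) → EuclideanSpace ℝ (Fin m))
    (t₀ : ℝ) (x₀ : EuclideanSpace ℝ (Fin m)) : Prop :=
  (∃ x, IsSolutionOn F x (Ici t₀) ∧ x t₀ = x₀) ∧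
  ∀ t₁ > t₀, ∀ x, IsSolutionOn F x (Ico t₀ t₁) → x t₀ = x₀ →
    ∃ y, IsSolutionOn F y (Ici t₀) ∧ EqOn x y (Ico t₀ t₁)

/-- The origin of the autonomous system `ż = h(z)` is globally asymptotically stable:
all solutions exist for all future times, the origin is stable, and every solution converges
to the origin. -/
structure IsGAS {m : ℕ} (h : EuclideanSpace ℝ (Fin m) → EuclideanSpace ℝ (Fin m)) : Prop where
  complete : ∀ z₀, ForwardCompleteFrom (fun _ => h) 0 z₀
  stable : ∀ ε > 0, ∃ δ > 0, ∀ z, IsSolutionOn (fun _ => h) z (Ici 0) →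
    ‖z 0‖ < δ → ∀ t ≥ 0, ‖z t‖ < ε
  attractive : ∀ z, IsSolutionOn (fun _ => h) z (Ici 0) → Tendsto z atTop (𝓝 0)

/-- Nested quantification over small parameters: there is `ε₁* > 0` such that for all
`ε₁ ∈ (0, ε₁*)` there is `ε₂* > 0` such that for all `ε₂ ∈ (0, ε₂*)` … the property
`P (ε₁, …, εₖ)` holds. The threshold `εⱼ*` may depend on `ε₁, …, εⱼ₋₁`. -/
def ForSmallParameters : (k : ℕ) → ((Fin k → ℝ) → Prop) → Prop
  | 0, P => P Fin.elim0
  | k + 1, P => ∃ ε' > 0, ∀ ε ∈ Ioo (0 : ℝ) ε',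
      ForSmallParameters k (fun e => P (Fin.cons ε e))

/-- For every initial time `t₀`, each solution of `ẋ = F(t, x)` with `‖x(t₀)‖ < c₁` exists on
`[t₀, ∞)` and satisfies `‖x(t)‖ < c₂` for all `t ≥ t₀ + T`. -/
def TrajectoryBound {m : ℕ}
    (F : ℝ → EuclideanSpace ℝ (Fin m) → EuclideanSpace ℝ (Fin m)) (c₁ c₂ T : ℝ) : Prop :=
  ∀ t₀ : ℝ, (∀ x₀, ‖x₀‖ < c₁ → ForwardCompleteFrom F t₀ x₀) ∧
    ∀ x, IsSolutionOn F x (Ici t₀) → ‖x t₀‖ < c₁ → ∀ t ≥ t₀ + T, ‖x t‖ < c₂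

section PracticalStability

variable {m k : ℕ}
  (F : (Fin k → ℝ) → ℝ → EuclideanSpace ℝ (Fin m) → EuclideanSpace ℝ (Fin m))

/-- Practical stability of the origin of `ẋ = F_ε(t, x)` with respect to the small parameter
vector `ε = (ε₁, …, εₖ)`. -/
def IsPracticallyStable : Prop :=
  ∀ c₂ > 0, ∃ c₁ > 0, ForSmallParameters k (fun ε => TrajectoryBound (F ε) c₁ c₂ 0)

/-- Practical boundedness. -/
def IsPracticallyBounded : Prop :=
  ∀ c₁ > 0, ∃ c₂ > 0, ForSmallParameters k (fun ε => TrajectoryBound (F ε) c₁ c₂ 0)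

/-- `δ`-practical uniform attractivity. -/
def IsPracticallyUniformlyAttractive (δ : ℝ) : Prop :=
  ∀ c₁ ∈ Ioo 0 δ, ∀ c₂ > 0, ∃ T ≥ 0,
    ForSmallParameters k (fun ε => TrajectoryBound (F ε) c₁ c₂ T)

/-- Semiglobal practical uniform asymptotic stability (for autonomous systems: semiglobal
practical asymptotic stability). -/
structure IsSGPUAS : Prop where
  stable : IsPracticallyStable F
  bounded : IsPracticallyBounded F
  attractive : ∀ δ > 0, IsPracticallyUniformlyAttractive F δ

end PracticalStability

/-- Regularity of the vector field `f(τ, x, a)`: for each `a > 0` it is continuous in `τ` and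
locally Lipschitz in `x`, uniformly in `τ` (the Lipschitz constant may depend on `a`). -/
structure IsRegularField {m : ℕ}
    (f : ℝ → EuclideanSpace ℝ (Fin m) → ℝ → EuclideanSpace ℝ (Fin m)) : Prop where
  continuous_time : ∀ a > 0, ∀ x, Continuous (fun τ => f τ x a)
  lipschitz : ∀ a > 0, ∀ r > 0, ∃ L : NNReal, ∀ τ,
    LipschitzOnWith L (fun x => f τ x a) (Metric.closedBall 0 r)

/-- `fbar(x, a) = lim_{T → ∞} (1/T) ∫_s^{s+T} f(τ, x, a) dτ`, uniformly in the initial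
phase `s`. -/
def IsAverageOf {m : ℕ}
    (f : ℝ → EuclideanSpace ℝ (Fin m) → ℝ → EuclideanSpace ℝ (Fin m))
    (fbar : EuclideanSpace ℝ (Fin m) → ℝ → EuclideanSpace ℝ (Fin m)) : Prop :=
  ∀ a > 0, ∀ x, TendstoUniformly
    (fun (T : ℝ) (s : ℝ) => T⁻¹ • ∫ τ in s..(s + T), f τ x a) (fun _ => fbar x a) atTop

/-- `h(z) = lim_{a → 0⁺} fbar(z, a)`, uniformly on compact sets. -/
def IsModelBasedLimit {m : ℕ}
    (fbar : EuclideanSpace ℝ (Fin m) → ℝ → EuclideanSpace ℝ (Fin m))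
    (h : EuclideanSpace ℝ (Fin m) → EuclideanSpace ℝ (Fin m)) : Prop :=
  TendstoLocallyUniformly (fun (a : ℝ) z => fbar z a) h (𝓝[>] 0)

/-- The average system `ẋ = fbar(x, a)` with parameter vector `(a)`. -/
def averageSystem {m : ℕ}
    (fbar : EuclideanSpace ℝ (Fin m) → ℝ → EuclideanSpace ℝ (Fin m)) :
    (Fin 1 → ℝ) → ℝ → EuclideanSpace ℝ (Fin m) → EuclideanSpace ℝ (Fin m) :=
  fun ε _ x => fbar x (ε 0)

/-- The model-free system `ẋ = f(ω t, x, a)` with parameter vector `(a, ω⁻¹)`. -/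
noncomputable def modelFreeSystem {m : ℕ}
    (f : ℝ → EuclideanSpace ℝ (Fin m) → ℝ → EuclideanSpace ℝ (Fin m)) :
    (Fin 2 → ℝ) → ℝ → EuclideanSpace ℝ (Fin m) → EuclideanSpace ℝ (Fin m) :=
  fun ε t x => f ((ε 1)⁻¹ * t) x (ε 0)

/-! Both systems are small perturbations of `ż = h(z)` in integral form: for small parameters, a
solution in the ball of radius `N` satisfies the integral equation of `h` on windows of length `N`
up to `1 / (N + 1)` (`ApproximatesField`, `IsApproxTrajectory`). The stability argument uses only
this closeness, so it serves both claims at once.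

The Lipschitz constants of `fbar(·, a)` may blow up as `a → 0`, so `h` is merely continuous and its
solutions need not be unique. Gronwall estimates are replaced by compactness: approximate
trajectories with vanishing error and bounded initial values converge along an ultrafilter,
uniformly on compact time intervals, to a solution of `h`; forward completeness excludes blow-up
(`exists_isSolutionOn_tendstoUniformlyOn`). Arguing by contradiction, one gets finite-horizon
shadowing and uniform attractivity of `h` on bounded sets. Shadowing over one horizon `T` brings a
small ball back into itself, and iteration gives bounds for all time (`IsGAS.approx_stable`).

For the average system the closeness is the uniform convergence `fbar → h`. For the model-free
system it also needs the averaging principle (`HasUniformMean.eventually_norm_sub_sub_integral_le`),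
proved by freezing the state on short subintervals. -/

/-! ### Solutions, their integral equation, and gluing of time intervals. -/

section SolutionBasics

variable {m : ℕ} {F : ℝ → EuclideanSpace ℝ (Fin m) → EuclideanSpace ℝ (Fin m)}
  {x : ℝ → EuclideanSpace ℝ (Fin m)}

theorem IsSolutionOn.mono {I J : Set ℝ} (hx : IsSolutionOn F x I) (hJ : J ⊆ I) :
    IsSolutionOn F x J :=
  fun t ht => (hx t (hJ ht)).mono hJ

theorem IsSolutionOn.continuousOn {I : Set ℝ} (hx : IsSolutionOn F x I) : ContinuousOn x I :=
  fun t ht => (hx t ht).continuousWithinAt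

theorem IsSolutionOn.congr {I : Set ℝ} {y : ℝ → EuclideanSpace ℝ (Fin m)}
    (hx : IsSolutionOn F x I) (h : EqOn y x I) : IsSolutionOn F y I := fun t ht => by
  rw [h ht]
  exact (hx t ht).congr_of_mem h ht

theorem IsSolutionOn.sub_eq_integral (hF : Continuous (Function.uncurry F)) {s t : ℝ} (hst : s ≤ t)
    (hx : IsSolutionOn F x (Icc s t)) : x t - x s = ∫ σ in s..t, F σ (x σ) := by
  have := ODE.picard_eq_of_hasDerivAt (f := F) (α := x) (t₀ := s) (t := t) (u := univ)
    hF.continuousOn (by rwa [uIcc_of_le hst]) (mapsTo_univ _ _)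
  rw [← this, ODE.picard_apply]
  simp

theorem IsSolutionOn.of_integral (hF : Continuous (Function.uncurry F)) {s t : ℝ} (hst : s ≤ t)
    (hc : ContinuousOn x (Icc s t))
    (hx : ∀ u ∈ Icc s t, x u = x s + ∫ σ in s..u, F σ (x σ)) : IsSolutionOn F x (Icc s t) := by
  intro u hu
  refine (ODE.hasDerivWithinAt_picard_Icc (f := F) (u := univ) (left_mem_Icc.2 hst)
    hF.continuousOn hc (fun _ _ => mem_univ _) (x s) hu).congr_of_mem (fun v hv => ?_) hu
  rw [ODE.picard_apply, hx v hv]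

/-- A curve that solves the equation on all compact intervals `[s, b]` solves it on `[s, ∞)`. -/
theorem IsSolutionOn.of_forall_Icc {s : ℝ} (hx : ∀ b > s, IsSolutionOn F x (Icc s b)) :
    IsSolutionOn F x (Ici s) := by
  intro t ht
  have hts : s ≤ t := ht
  refine (hx (t + 1) (by linarith) t ⟨ht, by linarith⟩).mono_of_mem_nhdsWithin ?_
  rw [mem_nhdsWithin]
  exact ⟨Iio (t + 1), isOpen_Iio, by simp, fun v hv => ⟨hv.2, le_of_lt hv.1⟩⟩

/-- As `IsSolutionOn.of_forall_Icc`, on a half-open interval. -/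
theorem IsSolutionOn.of_forall_Icc_Ico {s c : ℝ}
    (hx : ∀ b, s ≤ b → b < c → IsSolutionOn F x (Icc s b)) :
    IsSolutionOn F x (Ico s c) := by
  intro t ht
  obtain ⟨b, hb, hb'⟩ := exists_between ht.2
  refine (hx b (ht.1.trans hb.le) hb' t ⟨ht.1, hb.le⟩).mono_of_mem_nhdsWithin ?_
  rw [mem_nhdsWithin]
  exact ⟨Iio b, isOpen_Iio, hb, fun v hv => ⟨hv.2.1, le_of_lt hv.1⟩⟩

theorem IsSolutionOn.hasDerivWithinAt_Ici {s b : ℝ} (hx : IsSolutionOn F x (Icc s b)) {t : ℝ}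
    (ht : t ∈ Ico s b) : HasDerivWithinAt x (F t (x t)) (Ici t) t := by
  refine (hx t ⟨ht.1, ht.2.le⟩).mono_of_mem_nhdsWithin ?_
  rw [mem_nhdsWithin]
  exact ⟨Iio b, isOpen_Iio, ht.2, fun v hv => ⟨ht.1.trans hv.2, le_of_lt hv.1⟩⟩

end SolutionBasics

/-! ### Existence and uniqueness for locally Lipschitz fields. -/

/-- Continuity in time and local Lipschitz continuity in space, uniformly in time. -/
structure IsLipschitzField {m : ℕ}
    (F : ℝ → EuclideanSpace ℝ (Fin m) → EuclideanSpace ℝ (Fin m)) : Prop where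
  continuous_time : ∀ x, Continuous (fun t => F t x)
  lipschitz : ∀ r > 0, ∃ L : NNReal, ∀ t, LipschitzOnWith L (F t) (Metric.closedBall 0 r)

section Existence

variable {m : ℕ} {F : ℝ → EuclideanSpace ℝ (Fin m) → EuclideanSpace ℝ (Fin m)}

theorem IsLipschitzField.continuous (hF : IsLipschitzField F) :
    Continuous (Function.uncurry F) := by
  rw [continuous_iff_continuousAt]
  rintro ⟨t, x⟩
  obtain ⟨L, hL⟩ := hF.lipschitz (‖x‖ + 1) (by positivity)
  have := continuousOn_prod_of_continuousOn_lipschitzOnWith' (Function.uncurry F)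
    (s := univ) (t := Metric.closedBall 0 (‖x‖ + 1)) L (fun t _ => hL t)
    (fun x _ => (hF.continuous_time x).continuousOn)
  refine this.continuousAt (prod_mem_nhds univ_mem ?_)
  exact mem_of_superset (Metric.isOpen_ball.mem_nhds (by simp)) Metric.ball_subset_closedBall

theorem IsLipschitzField.eqOn_Icc (hF : IsLipschitzField F) {s b : ℝ}
    {x y : ℝ → EuclideanSpace ℝ (Fin m)} (hx : IsSolutionOn F x (Icc s b))
    (hy : IsSolutionOn F y (Icc s b)) (h : x s = y s) : EqOn x y (Icc s b) := by
  obtain ⟨r₁, h₁⟩ := (isCompact_Icc.image_of_continuousOn hx.continuousOn).isBounded.exists_norm_le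
  obtain ⟨r₂, h₂⟩ := (isCompact_Icc.image_of_continuousOn hy.continuousOn).isBounded.exists_norm_le
  obtain ⟨L, hL⟩ := hF.lipschitz (max 1 (max r₁ r₂)) (by positivity)
  refine ODE_solution_unique_of_mem_Icc_right (K := L)
    (s := fun _ => Metric.closedBall 0 (max 1 (max r₁ r₂))) (fun t _ => hL t) hx.continuousOn
    (fun t ht => hx.hasDerivWithinAt_Ici ht) (fun t ht => ?_) hy.continuousOn
    (fun t ht => hy.hasDerivWithinAt_Ici ht) (fun t ht => ?_) h
  · rw [mem_closedBall_zero_iff]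
    exact (h₁ _ (mem_image_of_mem _ ⟨ht.1, ht.2.le⟩)).trans (by simp)
  · rw [mem_closedBall_zero_iff]
    exact (h₂ _ (mem_image_of_mem _ ⟨ht.1, ht.2.le⟩)).trans (by simp)

theorem exists_isSolutionOn_Icc {K : NNReal} (hc : ∀ x, Continuous (fun t => F t x))
    (hK : ∀ t, LipschitzWith K (F t)) {s b L : ℝ} (hsb : s ≤ b)
    (hL : ∀ t ∈ Icc s b, ∀ x, ‖F t x‖ ≤ L) (x₀ : EuclideanSpace ℝ (Fin m)) :
    ∃ x, x s = x₀ ∧ IsSolutionOn F x (Icc s b) := by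
  have hL0 : 0 ≤ L := (norm_nonneg _).trans (hL s (left_mem_Icc.2 hsb) 0)
  have hsb' : 0 ≤ b - s := by linarith
  have : IsPicardLindelof F (tmin := s) (tmax := b) ⟨s, left_mem_Icc.2 hsb⟩ x₀
      (Real.toNNReal (L * (b - s))) 0 (Real.toNNReal L) K :=
    { lipschitzOnWith := fun t _ => (hK t).lipschitzOnWith
      continuousOn := fun x _ => (hc x).continuousOn
      norm_le := fun t ht x _ => (hL t ht x).trans (Real.le_coe_toNNReal L)
      mul_max_le := by
        rw [Real.coe_toNNReal _ hL0, Real.coe_toNNReal _ (by positivity)]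
        simp [hsb] }
  exact this.exists_eq_forall_mem_Icc_hasDerivWithinAt₀

/-- Solutions on `[s, s + n]` agree on overlaps by uniqueness, so reading the one with index `⌈t -
s⌉₊` at time `t` glues them. -/
theorem exists_isSolutionOn_Ici {K : NNReal} (hc : ∀ x, Continuous (fun t => F t x))
    (hK : ∀ t, LipschitzWith K (F t)) {s : ℝ}
    (hb : ∀ b, ∃ L, ∀ t ∈ Icc s b, ∀ x, ‖F t x‖ ≤ L) (x₀ : EuclideanSpace ℝ (Fin m)) :
    ∃ x, x s = x₀ ∧ IsSolutionOn F x (Ici s) := by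
  have hF : IsLipschitzField F := ⟨hc, fun r _ => ⟨K, fun t => (hK t).lipschitzOnWith⟩⟩
  have key : ∀ n : ℕ, ∃ x, x s = x₀ ∧ IsSolutionOn F x (Icc s (s + n)) := fun n => by
    obtain ⟨L, hL⟩ := hb (s + n)
    exact exists_isSolutionOn_Icc hc hK (by simp) hL x₀
  choose y hy0 hy using key
  have hyy : ∀ n k : ℕ, n ≤ k → EqOn (y n) (y k) (Icc s (s + n)) := fun n k hnk =>
    hF.eqOn_Icc (hy n) ((hy k).mono (Icc_subset_Icc_right (by simpa using hnk)))
      (by rw [hy0, hy0])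
  have hx : ∀ n : ℕ, EqOn (fun t => y ⌈t - s⌉₊ t) (y n) (Icc s (s + n)) := fun n t ht =>
    hyy _ _ (Nat.ceil_le.2 (by linarith [ht.2]))
      ⟨ht.1, by linarith [Nat.le_ceil (t - s)]⟩
  refine ⟨fun t => y ⌈t - s⌉₊ t, hy0 _, IsSolutionOn.of_forall_Icc fun b _ => ?_⟩
  obtain ⟨n, hn⟩ := exists_nat_ge (b - s)
  exact ((hy n).congr (hx n)).mono (Icc_subset_Icc_right (by linarith))

/-- The radial retraction onto the ball of radius `r`. -/
noncomputable def ballRetraction {m : ℕ} (r : ℝ) (x : EuclideanSpace ℝ (Fin m)) :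
    EuclideanSpace ℝ (Fin m) :=
  (r / max r ‖x‖) • x

theorem ballRetraction_of_norm_le {r : ℝ} (hr : 0 < r) {x : EuclideanSpace ℝ (Fin m)}
    (hx : ‖x‖ ≤ r) : ballRetraction r x = x := by
  rw [ballRetraction, max_eq_left hx, div_self hr.ne', one_smul]

theorem norm_ballRetraction_le {r : ℝ} (hr : 0 < r) (x : EuclideanSpace ℝ (Fin m)) :
    ‖ballRetraction r x‖ ≤ r := by
  have h : 0 < max r ‖x‖ := lt_max_of_lt_left hr
  rw [ballRetraction, norm_smul, Real.norm_of_nonneg (by positivity), div_mul_eq_mul_div,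
    div_le_iff₀ h]
  exact mul_le_mul_of_nonneg_left (le_max_right _ _) hr.le

theorem lipschitzWith_ballRetraction {r : ℝ} (hr : 0 < r) :
    LipschitzWith 2 (ballRetraction (m := m) r) := by
  refine LipschitzWith.of_dist_le_mul fun x y => ?_
  rw [dist_eq_norm, dist_eq_norm]
  have hx : 0 < max r ‖x‖ := lt_max_of_lt_left hr
  have hy : 0 < max r ‖y‖ := lt_max_of_lt_left hr
  -- Each of the two terms is at most `‖x - y‖`, whence the constant 2; its value is immaterial.
  have e : ballRetraction r x - ballRetraction r y
      = (r / max r ‖x‖) • (x - y) + (r / max r ‖x‖ - r / max r ‖y‖) • y := by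
    simp only [ballRetraction]; module
  have h1 : ‖(r / max r ‖x‖) • (x - y)‖ ≤ ‖x - y‖ := by
    rw [norm_smul, Real.norm_of_nonneg (by positivity)]
    exact mul_le_of_le_one_left (norm_nonneg _) ((div_le_one hx).2 (le_max_left _ _))
  have h2 : ‖(r / max r ‖x‖ - r / max r ‖y‖) • y‖ ≤ ‖x - y‖ := by
    have hm : |max r ‖y‖ - max r ‖x‖| ≤ ‖x - y‖ := by
      have := abs_max_sub_max_le_abs ‖y‖ ‖x‖ r
      rw [max_comm r, max_comm r]
      refine this.trans ?_
      rw [norm_sub_rev]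
      exact abs_norm_sub_norm_le y x
    have e2 : r / max r ‖x‖ - r / max r ‖y‖
        = (r / max r ‖x‖) * ((max r ‖y‖ - max r ‖x‖) / max r ‖y‖) := by
      field_simp
    rw [norm_smul, e2, Real.norm_eq_abs, abs_mul,
      abs_of_nonneg (by positivity : 0 ≤ r / max r ‖x‖), abs_div, abs_of_pos hy, mul_assoc,
      div_mul_eq_mul_div |max r ‖y‖ - max r ‖x‖|]
    have h3 : |max r ‖y‖ - max r ‖x‖| * ‖y‖ / max r ‖y‖ ≤ ‖x - y‖ := by
      rw [div_le_iff₀ hy]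
      exact mul_le_mul hm (le_max_right _ _) (norm_nonneg _) (norm_nonneg _)
    refine (mul_le_of_le_one_left (by positivity) ((div_le_one hx).2 (le_max_left _ _))).trans h3
  rw [e]
  refine (norm_add_le _ _).trans ?_
  push_cast
  linarith

/-- A locally Lipschitz field agrees on any ball with a field whose solutions are global. -/
theorem IsLipschitzField.exists_isSolutionOn_retraction (hF : IsLipschitzField F) {r : ℝ}
    (hr : 0 < r) (s : ℝ) (x₀ : EuclideanSpace ℝ (Fin m)) :
    ∃ x, x s = x₀ ∧ IsSolutionOn (fun t x => F t (ballRetraction r x)) x (Ici s) := by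
  obtain ⟨L, hL⟩ := hF.lipschitz r hr
  have hmem : ∀ x : EuclideanSpace ℝ (Fin m),
      ballRetraction r x ∈ Metric.closedBall (0 : EuclideanSpace ℝ (Fin m)) r := fun x =>
    mem_closedBall_zero_iff.2 (norm_ballRetraction_le hr x)
  refine exists_isSolutionOn_Ici (K := L * 2) (fun x => hF.continuous_time _) (fun t => ?_)
    (fun b => ?_) x₀
  · rw [← lipschitzOnWith_univ]
    exact (hL t).comp (lipschitzWith_ballRetraction hr).lipschitzOnWith fun x _ => hmem x
  · obtain ⟨C, hC⟩ := ((isCompact_Icc (a := s) (b := b)).prod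
      (isCompact_closedBall (0 : EuclideanSpace ℝ (Fin m)) r)).exists_bound_of_continuousOn
      hF.continuous.continuousOn
    exact ⟨C, fun t ht x => hC (t, ballRetraction r x) ⟨ht, hmem x⟩⟩

end Existence

/-! ### Approximate trajectories and their compactness. -/

/-- A curve of norm less than `C` up to each time at which it has not yet left the ball of
radius `C` never leaves this ball. -/
theorem forall_le_of_forall_lt_of_forall_le {g : ℝ → ℝ} {a b C : ℝ}
    (hg : ContinuousOn g (Icc a b))
    (h : ∀ u ∈ Icc a b, (∀ v ∈ Icc a u, g v ≤ C) → g u < C) (ha : g a ≤ C) :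
    ∀ u ∈ Icc a b, g u ≤ C := by
  intro u hu
  by_contra! hC
  have hS : IsCompact (Icc a u ∩ g ⁻¹' {C}) :=
    isCompact_Icc.of_isClosed_subset ((hg.mono (Icc_subset_Icc_right hu.2)).preimage_isClosed_of_isClosed
      isClosed_Icc isClosed_singleton) inter_subset_left
  have hne : (Icc a u ∩ g ⁻¹' {C}).Nonempty := by
    obtain ⟨v, hv, hv'⟩ := intermediate_value_Icc hu.1 (hg.mono (Icc_subset_Icc_right hu.2))
      ⟨ha, hC.le⟩
    exact ⟨v, hv, hv'⟩
  -- At the first time `v` with `g v = C`, the intermediate value theorem gives `g ≤ C` on `[a, v]`,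
  -- so the hypothesis forces `g v < C`.
  obtain ⟨v, ⟨hv, hgv⟩, hmin⟩ := hS.exists_isLeast hne
  refine (h v ⟨hv.1, hv.2.trans hu.2⟩ fun w hw => ?_).ne hgv
  by_contra! hwC
  obtain ⟨w', hw', hgw'⟩ := intermediate_value_Icc hw.1
    (hg.mono (Icc_subset_Icc_right (hw.2.trans (hv.2.trans hu.2)))) ⟨ha, hwC.le⟩
  have h1 : v ≤ w' := hmin ⟨⟨hw'.1, hw'.2.trans (hw.2.trans hv.2)⟩, hgw'⟩
  have h2 : w = v := le_antisymm hw.2 (h1.trans hw'.2)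
  rw [h2] at hwC
  exact hwC.ne' hgv

/-- As long as it stays in the ball of radius `N`, the curve `x` satisfies the integral equation
of `ẋ = h(x)` on time windows of length `N` up to an error `1 / (N + 1)`. -/
structure IsApproxTrajectory {m : ℕ} (h : EuclideanSpace ℝ (Fin m) → EuclideanSpace ℝ (Fin m))
    (N : ℕ) (x : ℝ → EuclideanSpace ℝ (Fin m)) : Prop where
  continuousOn : ContinuousOn x (Ici 0)
  error_le : ∀ s t : ℝ, 0 ≤ s → s ≤ t → t ≤ s + N → (∀ u ∈ Icc s t, ‖x u‖ ≤ N) →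
    ‖x t - x s - ∫ u in s..t, h (x u)‖ ≤ 1 / (N + 1)

section Approx

variable {m : ℕ} {h : EuclideanSpace ℝ (Fin m) → EuclideanSpace ℝ (Fin m)}

theorem IsApproxTrajectory.anti {N N' : ℕ} {x : ℝ → EuclideanSpace ℝ (Fin m)}
    (hx : IsApproxTrajectory h N x) (hN : N' ≤ N) : IsApproxTrajectory h N' x := by
  have hN' : (N' : ℝ) ≤ N := by exact_mod_cast hN
  refine ⟨hx.continuousOn, fun s t hs hst ht hu => ?_⟩
  refine (hx.error_le s t hs hst (by linarith) fun u hu' => (hu u hu').trans hN').trans ?_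
  exact one_div_le_one_div_of_le (by positivity) (by linarith)

theorem IsApproxTrajectory.shift {N : ℕ} {x : ℝ → EuclideanSpace ℝ (Fin m)}
    (hx : IsApproxTrajectory h N x) {c : ℝ} (hc : 0 ≤ c) :
    IsApproxTrajectory h N (fun t => x (t + c)) := by
  refine ⟨hx.continuousOn.comp (by fun_prop) fun t ht => add_nonneg ht hc,
    fun s t hs hst ht hu => ?_⟩
  have := hx.error_le (s + c) (t + c) (by linarith) (by linarith) (by linarith) fun u hu' => by
    simpa using hu (u - c) ⟨by linarith [hu'.1], by linarith [hu'.2]⟩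
  rwa [← intervalIntegral.integral_comp_add_right (fun u => h (x u))] at this

theorem IsSolutionOn.isApproxTrajectory (hh : Continuous h) {z : ℝ → EuclideanSpace ℝ (Fin m)}
    (hz : IsSolutionOn (fun _ => h) z (Ici 0)) (N : ℕ) : IsApproxTrajectory h N z := by
  refine ⟨hz.continuousOn, fun s t hs hst _ _ => ?_⟩
  rw [(hz.mono fun u hu => hs.trans hu.1 : IsSolutionOn _ z (Icc s t)).sub_eq_integral
    (by fun_prop) hst, sub_self, norm_zero]
  positivity

theorem IsApproxTrajectory.norm_sub_le {N : ℕ} {x : ℝ → EuclideanSpace ℝ (Fin m)}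
    (hx : IsApproxTrajectory h N x) {s t k M : ℝ} (hs : 0 ≤ s) (hst : s ≤ t) (ht : t ≤ s + N)
    (hk : k ≤ N) (hM : ∀ y, ‖y‖ ≤ k → ‖h y‖ ≤ M) (hu : ∀ u ∈ Icc s t, ‖x u‖ ≤ k) :
    ‖x t - x s‖ ≤ M * (t - s) + 1 / (N + 1) := by
  have h1 := hx.error_le s t hs hst ht fun u hu' => (hu u hu').trans hk
  have h2 : ‖∫ u in s..t, h (x u)‖ ≤ M * |t - s| :=
    intervalIntegral.norm_integral_le_of_norm_le_const fun u hu' => by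
      rw [uIoc_of_le hst] at hu'
      exact hM _ (hu u ⟨hu'.1.le, hu'.2⟩)
  rw [abs_of_nonneg (by linarith)] at h2
  have h3 := norm_add_le (x t - x s - ∫ u in s..t, h (x u)) (∫ u in s..t, h (x u))
  rw [sub_add_cancel] at h3
  linarith

variable {U : Ultrafilter ℕ} {x : ℕ → ℝ → EuclideanSpace ℝ (Fin m)}

/-- Uniform boundedness on `[0, t]` along an ultrafilter. -/
def BoundedUpTo (U : Ultrafilter ℕ) (x : ℕ → ℝ → EuclideanSpace ℝ (Fin m)) (t : ℝ) : Prop :=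
  ∃ k : ℝ, ∀ᶠ n in (U : Filter ℕ), ∀ s ∈ Icc 0 t, ‖x n s‖ ≤ k

theorem BoundedUpTo.mono {s t : ℝ} (ht : BoundedUpTo U x t) (hst : s ≤ t) : BoundedUpTo U x s := by
  obtain ⟨k, hk⟩ := ht
  exact ⟨k, hk.mono fun n hn u hu => hn u ⟨hu.1, hu.2.trans hst⟩⟩

/-- An ultrafilter on a compact ball converges, so no subsequence has to be extracted. Where
boundedness fails, `limUnder` may be a junk value. -/
theorem BoundedUpTo.tendsto_limUnder {t s : ℝ} (ht : BoundedUpTo U x t) (hs : s ∈ Icc 0 t) :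
    Tendsto (fun n => x n s) U (𝓝 (limUnder (U : Filter ℕ) fun n => x n s)) := by
  obtain ⟨k, hk⟩ := ht
  refine tendsto_nhds_limUnder ?_
  obtain ⟨z, -, hz⟩ := (isCompact_closedBall (0 : EuclideanSpace ℝ (Fin m)) k).ultrafilter_le_nhds
    (U.map fun n => x n s) (by
      rw [le_principal_iff]
      exact hk.mono fun n hn => mem_closedBall_zero_iff.2 (hn s hs))
  exact ⟨z, hz⟩

theorem exists_norm_le_of_continuous (hh : Continuous h) (k : ℝ) :
    ∃ M, 0 < M ∧ ∀ y, ‖y‖ ≤ k → ‖h y‖ ≤ M := by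
  obtain ⟨C, hC⟩ := (isCompact_closedBall (0 : EuclideanSpace ℝ (Fin m)) k).exists_bound_of_continuousOn
    hh.continuousOn
  exact ⟨max 1 C, by positivity, fun y hy =>
    (hC y (mem_closedBall_zero_iff.2 hy)).trans (le_max_right _ _)⟩

theorem eventually_nat_ge (hU : (U : Filter ℕ) ≤ atTop) (k : ℝ) :
    ∀ᶠ n : ℕ in (U : Filter ℕ), k ≤ n :=
  hU (tendsto_natCast_atTop_atTop.eventually_ge_atTop k)

theorem eventually_one_div_lt (hU : (U : Filter ℕ) ≤ atTop) {ε : ℝ} (hε : 0 < ε) :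
    ∀ᶠ n : ℕ in (U : Filter ℕ), 1 / ((n : ℝ) + 1) < ε :=
  hU (tendsto_one_div_add_atTop_nhds_zero_nat.eventually_lt_const hε)

/-- Arzelà–Ascoli with a vanishing defect: the curves are `M`-Lipschitz up to `1 / (n + 1)`, which
turns pointwise into uniform convergence. -/
theorem BoundedUpTo.tendstoUniformlyOn (hh : Continuous h) (hU : (U : Filter ℕ) ≤ atTop)
    (hx : ∀ n, IsApproxTrajectory h n (x n)) {T : ℝ} (hT : BoundedUpTo U x T) :
    TendstoUniformlyOn x (fun s => limUnder (U : Filter ℕ) fun n => x n s) U (Icc 0 T) := by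
  set z : ℝ → EuclideanSpace ℝ (Fin m) := fun s => limUnder (U : Filter ℕ) fun n => x n s with hz
  have hlim : ∀ s ∈ Icc 0 T, Tendsto (fun n => x n s) U (𝓝 (z s)) := fun s hs =>
    hT.tendsto_limUnder hs
  obtain ⟨k, hk⟩ := hT
  obtain ⟨M, hM0, hM⟩ := exists_norm_le_of_continuous hh k
  have hosc : ∀ᶠ n in (U : Filter ℕ), ∀ s ∈ Icc 0 T, ∀ t ∈ Icc 0 T,
      ‖x n t - x n s‖ ≤ M * |t - s| + 1 / (n + 1) := by
    filter_upwards [hk, eventually_nat_ge hU k, eventually_nat_ge hU T] with n h1 h2 h3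
    have key : ∀ s ∈ Icc 0 T, ∀ t ∈ Icc 0 T, s ≤ t →
        ‖x n t - x n s‖ ≤ M * |t - s| + 1 / (n + 1) := fun s hs t ht hst => by
      rw [abs_of_nonneg (by linarith)]
      exact (hx n).norm_sub_le hs.1 hst (by linarith [hs.1, ht.2]) h2 hM fun u hu =>
        h1 u ⟨hs.1.trans hu.1, hu.2.trans ht.2⟩
    intro s hs t ht
    rcases le_total s t with hst | hst
    · exact key s hs t ht hst
    · rw [norm_sub_rev, abs_sub_comm]
      exact key t ht s hs hst
  have hzosc : ∀ s ∈ Icc 0 T, ∀ t ∈ Icc 0 T, ‖z t - z s‖ ≤ M * |t - s| := by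
    intro s hs t ht
    refine le_of_forall_pos_le_add fun ε hε => ?_
    refine le_of_tendsto ((hlim t ht).sub (hlim s hs)).norm ?_
    filter_upwards [hosc, eventually_one_div_lt hU hε] with n h1 h2
    linarith [h1 s hs t ht]
  rw [← tendstoLocallyUniformlyOn_iff_tendstoUniformlyOn_of_compact isCompact_Icc,
    Metric.tendstoLocallyUniformlyOn_iff]
  intro ε hε s hs
  -- Four errors of `ε / 4`: the Lipschitz part and the defect of `x n`, its convergence at `s`, and
  -- the variation of `z`.
  refine ⟨Metric.ball s (ε / (4 * M)) ∩ Icc 0 T, ?_, ?_⟩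
  · rw [inter_comm]
    exact inter_mem_nhdsWithin _ (Metric.ball_mem_nhds _ (by positivity))
  · filter_upwards [hosc, eventually_one_div_lt hU (show 0 < ε / 4 by positivity),
      Metric.tendsto_nhds.1 (hlim s hs) (ε / 4) (by positivity)] with n h1 h2 h3 t ht
    have h4 := h1 s hs t ht.2
    have h5 := hzosc s hs t ht.2
    have h6 : M * |t - s| ≤ ε / 4 := by
      have : |t - s| < ε / (4 * M) := ht.1
      rw [lt_div_iff₀ (by positivity)] at this
      linarith
    rw [dist_comm, dist_eq_norm]
    rw [dist_eq_norm] at h3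
    have e : x n t - z t = (x n t - x n s) + (x n s - z s) - (z t - z s) := by abel
    rw [e]
    have h7 := norm_sub_le ((x n t - x n s) + (x n s - z s)) (z t - z s)
    have h8 := norm_add_le (x n t - x n s) (x n s - z s)
    linarith

theorem BoundedUpTo.isSolutionOn (hh : Continuous h) (hU : (U : Filter ℕ) ≤ atTop)
    (hx : ∀ n, IsApproxTrajectory h n (x n)) {T : ℝ} (hT : BoundedUpTo U x T) (hT0 : 0 ≤ T) :
    IsSolutionOn (fun _ => h) (fun s => limUnder (U : Filter ℕ) fun n => x n s) (Icc 0 T) := by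
  have hunif := hT.tendstoUniformlyOn hh hU hx
  set z : ℝ → EuclideanSpace ℝ (Fin m) := fun s => limUnder (U : Filter ℕ) fun n => x n s with hz
  have hlim : ∀ s ∈ Icc 0 T, Tendsto (fun n => x n s) U (𝓝 (z s)) := fun s hs =>
    hunif.tendsto_at hs
  obtain ⟨k, hk⟩ := hT
  have hxc : ∀ n, ContinuousOn (x n) (Icc 0 T) := fun n =>
    (hx n).continuousOn.mono fun s hs => hs.1
  have hzc : ContinuousOn z (Icc 0 T) := hunif.continuousOn (Eventually.of_forall hxc).frequently
  have hzk : ∀ s ∈ Icc 0 T, ‖z s‖ ≤ k := fun s hs =>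
    le_of_tendsto (hlim s hs).norm (hk.mono fun n hn => hn s hs)
  have hhunif : TendstoUniformlyOn (fun n s => h (x n s)) (fun s => h (z s)) U (Icc 0 T) := by
    have huc := (isCompact_closedBall (0 : EuclideanSpace ℝ (Fin m)) k).uniformContinuousOn_of_continuous
      hh.continuousOn
    rw [Metric.uniformContinuousOn_iff] at huc
    rw [Metric.tendstoUniformlyOn_iff] at hunif ⊢
    intro ε hε
    obtain ⟨δ, hδ, H⟩ := huc ε hε
    filter_upwards [hk, hunif δ hδ] with n h1 h2 s hs
    exact H _ (mem_closedBall_zero_iff.2 (hzk s hs)) _ (mem_closedBall_zero_iff.2 (h1 s hs))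
      (h2 s hs)
  refine IsSolutionOn.of_integral (by fun_prop) hT0 hzc fun t ht => ?_
  have hsub : uIcc 0 t ⊆ Icc 0 T := by
    rw [uIcc_of_le ht.1]; exact Icc_subset_Icc_right ht.2
  suffices H : ‖z t - z 0 - ∫ u in (0 : ℝ)..t, h (z u)‖ ≤ 0 by
    have := norm_le_zero_iff.1 H
    rw [sub_sub, sub_eq_zero] at this
    exact this
  have hint : Tendsto (fun n => ∫ u in (0 : ℝ)..t, h (x n u)) U
      (𝓝 (∫ u in (0 : ℝ)..t, h (z u))) := by
    rw [Metric.tendsto_nhds]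
    intro ε hε
    filter_upwards [Metric.tendstoUniformlyOn_iff.1 hhunif (ε / (T + 1)) (by positivity)]
      with n hn
    have h1 : IntervalIntegrable (fun u => h (x n u)) MeasureTheory.volume 0 t :=
      (hh.comp_continuousOn ((hxc n).mono hsub)).intervalIntegrable
    have h2 : IntervalIntegrable (fun u => h (z u)) MeasureTheory.volume 0 t :=
      (hh.comp_continuousOn (hzc.mono hsub)).intervalIntegrable
    rw [dist_eq_norm, ← intervalIntegral.integral_sub h1 h2]
    refine (intervalIntegral.norm_integral_le_of_norm_le_const (C := ε / (T + 1))
      fun u hu => ?_).trans_lt ?_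
    · rw [← dist_eq_norm, dist_comm]
      exact (hn u (hsub (uIoc_subset_uIcc hu))).le
    · rw [sub_zero, abs_of_nonneg ht.1, div_mul_eq_mul_div, div_lt_iff₀ (by positivity)]
      exact mul_lt_mul_of_pos_left (by linarith [ht.2]) hε
  refine le_of_forall_pos_le_add fun ε hε => ?_
  refine le_of_tendsto (((hlim t ht).sub (hlim 0 ⟨le_rfl, hT0⟩)).sub hint).norm ?_
  filter_upwards [hk, eventually_nat_ge hU k, eventually_nat_ge hU T,
    eventually_one_div_lt hU hε] with n h1 h2 h3 h4
  have := (hx n).error_le 0 t le_rfl ht.1 (by linarith [ht.2]) fun u hu =>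
    (h1 u ⟨hu.1, hu.2.trans ht.2⟩).trans h2
  linarith

/-- The step `δ` depends only on `k`: curves starting below `k + 1` with speed at most `M` gain at
most 1 in time `1 / M`, plus a defect below 1, so they never reach `k + 3`. -/
theorem exists_forall_boundedUpTo_add (hh : Continuous h) (hU : (U : Filter ℕ) ≤ atTop)
    (hx : ∀ n, IsApproxTrajectory h n (x n)) (k : ℝ) :
    ∃ δ > 0, ∀ t, 0 ≤ t → BoundedUpTo U x t → ‖limUnder (U : Filter ℕ) fun n => x n t‖ ≤ k →
      BoundedUpTo U x (t + δ) := by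
  obtain ⟨M, hM0, hM⟩ := exists_norm_le_of_continuous hh (k + 3)
  refine ⟨1 / M, by positivity, fun t ht hb hzt => ?_⟩
  have hlim := hb.tendsto_limUnder (right_mem_Icc.2 ht)
  obtain ⟨k', hk'⟩ := hb
  refine ⟨max k' (k + 3), ?_⟩
  filter_upwards [hk', hlim.norm.eventually_lt_const (show _ < k + 1 by linarith),
    eventually_nat_ge hU (k + 3), eventually_nat_ge hU (1 / M),
    eventually_one_div_lt hU one_pos] with n h1 h2 h3 h4 h5 s hs
  rcases le_total s t with hst | hst
  · exact (h1 s ⟨hs.1, hst⟩).trans (le_max_left _ _)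
  refine le_trans ?_ (le_max_right _ _)
  refine forall_le_of_forall_lt_of_forall_le (g := fun s => ‖x n s‖) (a := t) (b := t + 1 / M)
    ((hx n).continuousOn.norm.mono fun u hu => ht.trans hu.1) (fun u hu hu' => ?_)
    (by linarith) s ⟨hst, hs.2⟩
  have h6 := (hx n).norm_sub_le ht hu.1 (by linarith [hu.2]) h3 hM hu'
  have h7 : M * (u - t) ≤ 1 := by
    have : u - t ≤ 1 / M := by linarith [hu.2]
    rw [le_div_iff₀ hM0] at this
    linarith
  have h8 := norm_add_le (x n u - x n t) (x n t)
  rw [sub_add_cancel] at h8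
  linarith

/-- If boundedness ended at a finite `τ`, the limit would solve the equation on `[0, τ)`.
Completeness extends this solution beyond `τ`, so it is bounded there, and the uniform step `δ`
taken from `τ - δ / 2` passes `τ`. -/
theorem boundedUpTo_of_forwardComplete (hh : Continuous h)
    (hcomp : ∀ z₀, ForwardCompleteFrom (fun _ => h) 0 z₀) (hU : (U : Filter ℕ) ≤ atTop)
    (hx : ∀ n, IsApproxTrajectory h n (x n)) {r : ℝ} (hr : ∀ n, ‖x n 0‖ ≤ r) (b : ℝ) :
    BoundedUpTo U x b := by
  by_contra hnb
  set z : ℝ → EuclideanSpace ℝ (Fin m) := fun s => limUnder (U : Filter ℕ) fun n => x n s with hz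
  set S : Set ℝ := {t | 0 ≤ t ∧ BoundedUpTo U x t}
  have h0 : (0 : ℝ) ∈ S := ⟨le_rfl, r, Eventually.of_forall fun n s hs => by
    obtain rfl : s = 0 := le_antisymm hs.2 hs.1
    exact hr n⟩
  have hSb : BddAbove S := ⟨b, fun t ht => by
    by_contra! hbt
    exact hnb (ht.2.mono hbt.le)⟩
  set τ := sSup S with hτ
  have hτ0 : 0 ≤ τ := le_csSup hSb h0
  have hlt : ∀ t, 0 ≤ t → t < τ → BoundedUpTo U x t := fun t _ ht => by
    obtain ⟨t', ht', htt'⟩ := exists_lt_of_lt_csSup ⟨0, h0⟩ ht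
    exact ht'.2.mono htt'.le
  -- The point 0 is inserted because `Ico 0 τ` is empty when `τ = 0`.
  obtain ⟨k, hk⟩ : ∃ k, ∀ t ∈ insert 0 (Ico 0 τ), ‖z t‖ ≤ k := by
    rcases hτ0.eq_or_lt with hτ0 | hτ0
    · refine ⟨‖z 0‖, fun t ht => ?_⟩
      simp only [← hτ0, Ico_self, insert_empty_eq, mem_singleton_iff] at ht
      rw [ht]
    · have hsol : IsSolutionOn (fun _ => h) z (Ico 0 τ) :=
        IsSolutionOn.of_forall_Icc_Ico fun t h0t ht => (hlt t h0t ht).isSolutionOn hh hU hx h0t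
      obtain ⟨y, hy, hzy⟩ := (hcomp (z 0)).2 τ hτ0 z hsol rfl
      obtain ⟨C, hC⟩ := (isCompact_Icc (a := (0 : ℝ)) (b := τ)).exists_bound_of_continuousOn
        (hy.continuousOn.mono fun t ht => ht.1)
      refine ⟨C, fun t ht => ?_⟩
      rw [insert_eq_of_mem (left_mem_Ico.2 hτ0)] at ht
      rw [hzy ht]
      exact hC t ⟨ht.1, ht.2.le⟩
  obtain ⟨δ, hδ, H⟩ := exists_forall_boundedUpTo_add hh hU hx k
  have key : BoundedUpTo U x (max 0 (τ - δ / 2) + δ) := by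
    rcases hτ0.eq_or_lt with hτ0 | hτ0
    · rw [max_eq_left (by linarith)]
      exact H 0 le_rfl h0.2 (hk 0 (mem_insert _ _))
    · have h1 : max 0 (τ - δ / 2) < τ := max_lt hτ0 (by linarith)
      exact H _ (le_max_left _ _) (hlt _ (le_max_left _ _) h1)
        (hk _ (mem_insert_of_mem _ ⟨le_max_left _ _, h1⟩))
  have h2 : max 0 (τ - δ / 2) + δ ≤ τ :=
    le_csSup hSb ⟨add_nonneg (le_max_left _ _) hδ.le, key⟩
  linarith [le_max_right 0 (τ - δ / 2)]

/-- Approximate trajectories of increasing accuracy accumulate at a solution. -/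
theorem exists_isSolutionOn_tendstoUniformlyOn (hh : Continuous h)
    (hcomp : ∀ z₀, ForwardCompleteFrom (fun _ => h) 0 z₀) (hU : (U : Filter ℕ) ≤ atTop)
    (hx : ∀ n, IsApproxTrajectory h n (x n)) {r : ℝ} (hr : ∀ n, ‖x n 0‖ ≤ r) :
    ∃ z, IsSolutionOn (fun _ => h) z (Ici 0) ∧ ‖z 0‖ ≤ r ∧
      ∀ T, TendstoUniformlyOn x z U (Icc 0 T) := by
  have hb := boundedUpTo_of_forwardComplete hh hcomp hU hx hr
  refine ⟨fun s => limUnder (U : Filter ℕ) fun n => x n s,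
    IsSolutionOn.of_forall_Icc fun T hT => (hb T).isSolutionOn hh hU hx hT.le, ?_,
    fun T => (hb T).tendstoUniformlyOn hh hU hx⟩
  exact le_of_tendsto ((hb 0).tendsto_limUnder (by simp)).norm (Eventually.of_forall hr)

end Approx

/-! ### From asymptotic stability of `h` to bounds on approximate trajectories. -/

section GlobalAsymptoticStability

variable {m : ℕ} {h : EuclideanSpace ℝ (Fin m) → EuclideanSpace ℝ (Fin m)}

theorem IsSolutionOn.shift {z : ℝ → EuclideanSpace ℝ (Fin m)}
    (hz : IsSolutionOn (fun _ => h) z (Ici 0)) {c : ℝ} (hc : 0 ≤ c) :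
    IsSolutionOn (fun _ => h) (fun t => z (t + c)) (Ici 0) := fun t ht => by
  have hmaps : MapsTo (fun t => t + c) (Ici (0 : ℝ)) (Ici 0) := fun t ht => add_nonneg ht hc
  have := (hz (t + c) (hmaps ht)).scomp t ((hasDerivAt_id t).add_const c).hasDerivWithinAt hmaps
  rwa [one_smul] at this

/-- On a finite horizon, accurate approximate trajectories are shadowed by solutions. -/
theorem exists_isSolutionOn_norm_sub_lt (hh : Continuous h)
    (hcomp : ∀ z₀, ForwardCompleteFrom (fun _ => h) 0 z₀) (r T : ℝ) {η : ℝ} (hη : 0 < η) :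
    ∃ N, ∀ x, IsApproxTrajectory h N x → ‖x 0‖ ≤ r →
      ∃ z, IsSolutionOn (fun _ => h) z (Ici 0) ∧ ‖z 0‖ ≤ r ∧ ∀ t ∈ Icc 0 T, ‖x t - z t‖ < η := by
  -- A counterexample for every `N` gives a sequence whose limit solution shadows some of its
  -- members, a contradiction.
  by_contra! H
  choose x hx hr hxz using H
  obtain ⟨z, hz, hz0, hlim⟩ :=
    exists_isSolutionOn_tendstoUniformlyOn hh hcomp Nat.hyperfilter_le_atTop hx hr
  obtain ⟨n, hn⟩ := (Metric.tendstoUniformlyOn_iff.1 (hlim T) η hη).exists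
  obtain ⟨t, ht, hle⟩ := hxz n z hz hz0
  have := hn t ht
  rw [dist_comm, dist_eq_norm] at this
  linarith

theorem exists_forall_approx_norm_le (hh : Continuous h)
    (hcomp : ∀ z₀, ForwardCompleteFrom (fun _ => h) 0 z₀) (r T : ℝ) :
    ∃ (N : ℕ) (B : ℝ), ∀ x, IsApproxTrajectory h N x → ‖x 0‖ ≤ r → ∀ t ∈ Icc 0 T, ‖x t‖ ≤ B := by
  by_contra! H
  -- Diagonal choice: accuracy and violated bound grow together, while the limit is bounded on `[0,
  -- T]`.
  have H' := fun n : ℕ => H n n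
  choose x hx hr t ht htn using H'
  obtain ⟨z, hz, -, hlim⟩ :=
    exists_isSolutionOn_tendstoUniformlyOn hh hcomp Nat.hyperfilter_le_atTop hx hr
  obtain ⟨C, hC⟩ := (isCompact_Icc (a := (0 : ℝ)) (b := T)).exists_bound_of_continuousOn
    (hz.continuousOn.mono fun t ht => ht.1)
  obtain ⟨n, hn, hCn⟩ := ((Metric.tendstoUniformlyOn_iff.1 (hlim T) 1 one_pos).and
    (eventually_nat_ge Nat.hyperfilter_le_atTop (C + 1))).exists
  have h1 := hn (t n) (ht n)
  rw [dist_comm, dist_eq_norm] at h1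
  have h2 := norm_add_le (x n (t n) - z (t n)) (z (t n))
  rw [sub_add_cancel] at h2
  linarith [hC (t n) (ht n), htn n]

/-- Global asymptotic stability is uniform on bounded sets of initial conditions. -/
theorem IsGAS.uniformly_attractive (hG : IsGAS h) (hh : Continuous h) (r : ℝ) {c : ℝ}
    (hc : 0 < c) :
    ∃ T > 0, ∀ z, IsSolutionOn (fun _ => h) z (Ici 0) → ‖z 0‖ ≤ r → ∀ t ≥ T, ‖z t‖ < c := by
  obtain ⟨δ, hδ, hstab⟩ := hG.stable c hc
  by_contra! H
  have H' := fun n : ℕ => H (n + 1) (by positivity)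
  choose z hz hr t ht htc using H'
  -- Entering the `δ`-ball before time `n` would keep `z n` below `c` at the later time `t n`. Hence
  -- a limit solution never enters the `δ`-ball, against attractivity.
  have hfar : ∀ n : ℕ, ∀ s ∈ Icc 0 (n : ℝ), δ ≤ ‖z n s‖ := fun n s hs => by
    by_contra! hlt
    have := hstab _ ((hz n).shift hs.1) (by simpa using hlt) (t n - s)
      (by linarith [ht n, hs.2])
    rw [sub_add_cancel] at this
    linarith [htc n]
  obtain ⟨y, hy, -, hlim⟩ := exists_isSolutionOn_tendstoUniformlyOn hh hG.complete
    Nat.hyperfilter_le_atTop (fun n => (hz n).isApproxTrajectory hh n) hr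
  have hy0 := (hG.attractive y hy).norm
  rw [norm_zero] at hy0
  obtain ⟨s, hs, hs0⟩ := ((hy0.eventually_lt_const hδ).and (eventually_ge_atTop 0)).exists
  have hzs := ((hlim s).tendsto_at (right_mem_Icc.2 hs0)).norm
  obtain ⟨n, h1, h2⟩ := ((hzs.eventually_lt_const hs).and
    (eventually_nat_ge Nat.hyperfilter_le_atTop s)).exists
  linarith [hfar n s ⟨hs0, h2⟩]

/-- All sufficiently accurate approximate trajectories that start in the ball of radius `c₁` are
uniformly bounded and stay in the ball of radius `c₂` from time `T` on. -/
def HasApproxTrajectoryBound {m : ℕ} (h : EuclideanSpace ℝ (Fin m) → EuclideanSpace ℝ (Fin m))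
    (c₁ c₂ T : ℝ) : Prop :=
  ∃ (N : ℕ) (B : ℝ), ∀ x, IsApproxTrajectory h N x → ‖x 0‖ < c₁ →
    (∀ t ≥ 0, ‖x t‖ ≤ B) ∧ ∀ t ≥ T, ‖x t‖ < c₂

/-- Over one horizon `T`, attraction to `δ / 4` plus a shadowing error `δ / 4` returns the `δ /
2`-ball to itself; in between, stability (`c₂ / 2`) plus error (`c₂ / 2`) stays below `c₂`.
Approximate trajectories are shift invariant, so this iterates. -/
theorem IsGAS.approx_stable (hG : IsGAS h) (hh : Continuous h) {c₂ : ℝ} (hc₂ : 0 < c₂) :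
    ∃ c₁ > 0, ∃ N, ∀ x, IsApproxTrajectory h N x → ‖x 0‖ < c₁ → ∀ t ≥ 0, ‖x t‖ < c₂ := by
  obtain ⟨δ, hδ, hstab⟩ := hG.stable (c₂ / 2) (by positivity)
  obtain ⟨T, hT, hattr⟩ := hG.uniformly_attractive hh (δ / 2) (show 0 < δ / 4 by positivity)
  obtain ⟨N, hN⟩ := exists_isSolutionOn_norm_sub_lt hh hG.complete (δ / 2) T
    (show 0 < min (δ / 4) (c₂ / 2) by positivity)
  refine ⟨δ / 2, by positivity, N, fun x hx hx0 => ?_⟩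
  have step : ∀ y, IsApproxTrajectory h N y → ‖y 0‖ < δ / 2 →
      ‖y T‖ < δ / 2 ∧ ∀ t ∈ Icc 0 T, ‖y t‖ < c₂ := fun y hy hy0 => by
    obtain ⟨z, hz, hz0, hyz⟩ := hN y hy hy0.le
    have hle : ∀ t, ‖y t‖ ≤ ‖y t - z t‖ + ‖z t‖ := fun t => by
      simpa using norm_add_le (y t - z t) (z t)
    refine ⟨?_, fun t ht => ?_⟩
    · linarith [hle T, hattr z hz hz0 T le_rfl,
        (hyz T ⟨hT.le, le_rfl⟩).trans_le (min_le_left _ _)]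
    · linarith [hle t, hstab z hz (by linarith) t ht.1, (hyz t ht).trans_le (min_le_right _ _)]
  have hiter : ∀ k : ℕ, ‖x (k * T)‖ < δ / 2 := fun k => by
    induction k with
    | zero => simpa using hx0
    | succ k ih =>
      have := (step _ (hx.shift (by positivity : 0 ≤ k * T)) (by simpa using ih)).1
      rw [show T + k * T = (k + 1 : ℕ) * T by push_cast; ring] at this
      exact this
  intro t ht
  have h1 := (step _ (hx.shift (by positivity : 0 ≤ ⌊t / T⌋₊ * T))
    (by simpa using hiter ⌊t / T⌋₊)).2 (t - ⌊t / T⌋₊ * T) ⟨?_, ?_⟩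
  · simpa using h1
  · have := Nat.floor_le (show 0 ≤ t / T by positivity)
    rw [le_div_iff₀ hT] at this
    linarith
  · have := (Nat.lt_floor_add_one (t / T)).le
    rw [div_le_iff₀ hT] at this
    linarith

theorem IsGAS.exists_hasApproxTrajectoryBound_stable (hG : IsGAS h) (hh : Continuous h) {c₂ : ℝ}
    (hc₂ : 0 < c₂) : ∃ c₁ > 0, HasApproxTrajectoryBound h c₁ c₂ 0 := by
  obtain ⟨c₁, hc₁, N, hN⟩ := hG.approx_stable hh hc₂
  exact ⟨c₁, hc₁, N, c₂, fun x hx hx0 => ⟨fun t ht => (hN x hx hx0 t ht).le, hN x hx hx0⟩⟩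

/-- At time `T` the shadowing solution is within `δ / 2` of the origin and the error is below `δ /
2`; from then on `IsGAS.approx_stable` takes over. -/
theorem IsGAS.exists_hasApproxTrajectoryBound_attractive (hG : IsGAS h) (hh : Continuous h)
    (c₁ : ℝ) {c₂ : ℝ} (hc₂ : 0 < c₂) : ∃ T ≥ 0, HasApproxTrajectoryBound h c₁ c₂ T := by
  obtain ⟨δ, hδ, N₁, hN₁⟩ := hG.approx_stable hh hc₂
  obtain ⟨T, hT, hattr⟩ := hG.uniformly_attractive hh c₁ (show 0 < δ / 2 by positivity)
  obtain ⟨N₂, hN₂⟩ := exists_isSolutionOn_norm_sub_lt hh hG.complete c₁ T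
    (show 0 < δ / 2 by positivity)
  obtain ⟨N₃, B, hB⟩ := exists_forall_approx_norm_le hh hG.complete c₁ T
  have key : ∀ x, IsApproxTrajectory h (max N₁ (max N₂ N₃)) x → ‖x 0‖ < c₁ →
      ∀ t ≥ T, ‖x t‖ < c₂ := fun x hx hx0 t ht => by
    obtain ⟨z, hz, hz0, hxz⟩ := hN₂ x (hx.anti (by simp)) hx0.le
    have h1 : ‖x T‖ ≤ ‖x T - z T‖ + ‖z T‖ := by simpa using norm_add_le (x T - z T) (z T)
    have h2 := hN₁ _ ((hx.anti (by simp)).shift hT.le) (by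
      simp only [zero_add]
      linarith [hattr z hz hz0 T le_rfl, hxz T ⟨hT.le, le_rfl⟩]) (t - T) (by linarith)
    simpa using h2
  refine ⟨T, hT.le, max N₁ (max N₂ N₃), max B c₂, fun x hx hx0 => ⟨fun t ht => ?_, key x hx hx0⟩⟩
  rcases le_total t T with htT | htT
  · exact (hB x (hx.anti (by simp)) hx0.le t ⟨ht, htT⟩).trans (le_max_left _ _)
  · exact (key x hx hx0 t htT).le.trans (le_max_right _ _)

theorem IsGAS.exists_hasApproxTrajectoryBound_bounded (hG : IsGAS h) (hh : Continuous h)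
    (c₁ : ℝ) : ∃ c₂ > 0, HasApproxTrajectoryBound h c₁ c₂ 0 := by
  obtain ⟨T, -, N, B, hB⟩ := hG.exists_hasApproxTrajectoryBound_attractive hh c₁ one_pos
  refine ⟨|B| + 1, by positivity, N, B, fun x hx hx0 => ⟨(hB x hx hx0).1, fun t ht => ?_⟩⟩
  linarith [(hB x hx hx0).1 t ht, le_abs_self B]

end GlobalAsymptoticStability

/-! ### Transfer from approximate trajectories to the parametrised systems. -/

/-- Solutions of `ẋ = F(t, x)` are, as long as they stay in the ball of radius `N`, solutions of
`ẋ = h(x)` up to an error `1 / (N + 1)` on time windows of length `N`. -/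
structure ApproximatesField {m : ℕ} (h : EuclideanSpace ℝ (Fin m) → EuclideanSpace ℝ (Fin m))
    (N : ℕ) (F : ℝ → EuclideanSpace ℝ (Fin m) → EuclideanSpace ℝ (Fin m)) : Prop where
  isLipschitzField : IsLipschitzField F
  error_le : ∀ s t : ℝ, s ≤ t → t ≤ s + N → ∀ x, IsSolutionOn F x (Icc s t) →
    (∀ u ∈ Icc s t, ‖x u‖ ≤ N) → ‖x t - x s - ∫ u in s..t, h (x u)‖ ≤ 1 / (N + 1)

section Transfer

variable {m : ℕ} {h : EuclideanSpace ℝ (Fin m) → EuclideanSpace ℝ (Fin m)}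
  {F : ℝ → EuclideanSpace ℝ (Fin m) → EuclideanSpace ℝ (Fin m)}

/-- The curve has to solve the equation only on windows where it stays in the ball; this admits
solutions of the retracted field before their boundedness is known. -/
theorem ApproximatesField.isApproxTrajectory {N : ℕ} (hF : ApproximatesField h N F) {t₀ : ℝ}
    {y : ℝ → EuclideanSpace ℝ (Fin m)} (hc : ContinuousOn y (Ici t₀))
    (hy : ∀ s t, t₀ ≤ s → (∀ u ∈ Icc s t, ‖y u‖ ≤ N) → IsSolutionOn F y (Icc s t)) :
    IsApproxTrajectory h N (fun t => y (t + t₀)) := by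
  refine ⟨hc.comp (by fun_prop) fun t ht => le_add_of_nonneg_left (mem_Ici.1 ht), fun s t hs hst ht hu => ?_⟩
  have hu' : ∀ u ∈ Icc (s + t₀) (t + t₀), ‖y u‖ ≤ N := fun u hu' => by
    simpa using hu (u - t₀) ⟨by linarith [hu'.1], by linarith [hu'.2]⟩
  have := hF.error_le (s + t₀) (t + t₀) (by linarith) (by linarith) y
    (hy _ _ (by linarith) hu') hu'
  rwa [← intervalIntegral.integral_comp_add_right (fun u => h (y u))] at this

/-- With `N ≥ B`, a global solution of the retracted field stays where the retraction is the
identity. It therefore solves the original equation, and uniqueness excludes escape of any other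
solution. -/
theorem HasApproxTrajectoryBound.exists_trajectoryBound {c₁ c₂ T : ℝ}
    (hB : HasApproxTrajectoryBound h c₁ c₂ T) :
    ∃ N, ∀ F, ApproximatesField h N F → TrajectoryBound F c₁ c₂ T := by
  obtain ⟨N₀, B, hB⟩ := hB
  -- The summand 1 makes the retraction radius positive.
  refine ⟨max N₀ ⌈B⌉₊ + 1, fun F hF t₀ => ?_⟩
  set N := max N₀ ⌈B⌉₊ + 1 with hN
  have hBN : B ≤ N := (Nat.le_ceil B).trans
    (by exact_mod_cast (le_max_right _ _).trans (Nat.le_succ _))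
  have hN₀ : N₀ ≤ N := (le_max_left _ _).trans (Nat.le_succ _)
  have hN0 : (0 : ℝ) < N := by rw [hN]; positivity
  have bound : ∀ y, ContinuousOn y (Ici t₀) →
      (∀ s t, t₀ ≤ s → (∀ u ∈ Icc s t, ‖y u‖ ≤ N) → IsSolutionOn F y (Icc s t)) → ‖y t₀‖ < c₁ →
      (∀ t ≥ t₀, ‖y t‖ ≤ N) ∧ ∀ t ≥ t₀ + T, ‖y t‖ < c₂ := fun y hc hy hy0 => by
    obtain ⟨h1, h2⟩ := hB _ ((hF.isApproxTrajectory hc hy).anti hN₀) (by simpa using hy0)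
    refine ⟨fun t ht => ?_, fun t ht => ?_⟩
    · simpa using (h1 (t - t₀) (by linarith)).trans hBN
    · simpa using h2 (t - t₀) (by linarith)
  refine ⟨fun x₀ hx₀ => ?_, fun x hx hx0 t ht => ?_⟩
  · obtain ⟨y, hy0, hy⟩ := hF.isLipschitzField.exists_isSolutionOn_retraction hN0 t₀ x₀
    have hyF : ∀ I, I ⊆ Ici t₀ → (∀ u ∈ I, ‖y u‖ ≤ N) → IsSolutionOn F y I := fun I hI hu t ht => by
      have := hy.mono hI t ht
      simpa only [ballRetraction_of_norm_le hN0 (hu t ht)] using this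
    have hyN := (bound y hy.continuousOn
      (fun s t hs hu => hyF _ (fun u hu' => hs.trans hu'.1) hu) (by rwa [hy0])).1
    have hyF' := hyF _ subset_rfl hyN
    refine ⟨⟨y, hyF', hy0⟩, fun t₁ _ x hx hx0 => ⟨y, hyF', fun t ht => ?_⟩⟩
    exact hF.isLipschitzField.eqOn_Icc (s := t₀) (b := t)
      (hx.mono fun u hu => ⟨hu.1, hu.2.trans_lt ht.2⟩) (hyF'.mono fun u hu => hu.1)
      (by rw [hx0, hy0]) (right_mem_Icc.2 ht.1)
  · exact (bound x hx.continuousOn (fun s t hs _ => hx.mono fun u hu => hs.trans hu.1) hx0).2 t ht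

theorem ForSmallParameters.mono {k : ℕ} {P Q : (Fin k → ℝ) → Prop} (hP : ForSmallParameters k P)
    (hPQ : ∀ ε, P ε → Q ε) : ForSmallParameters k Q := by
  induction k with
  | zero => exact hPQ _ hP
  | succ k ih =>
    obtain ⟨ε', hε', H⟩ := hP
    exact ⟨ε', hε', fun ε hε => ih (H ε hε) fun e => hPQ _⟩

/-- The radii and `T` come from `h` alone, before any parameter is chosen, as the order of
quantifiers requires. -/
theorem IsGAS.isSGPUAS (hG : IsGAS h) (hh : Continuous h) {k : ℕ}
    {F : (Fin k → ℝ) → ℝ → EuclideanSpace ℝ (Fin m) → EuclideanSpace ℝ (Fin m)}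
    (hF : ∀ N, ForSmallParameters k fun ε => ApproximatesField h N (F ε)) : IsSGPUAS F := by
  have key : ∀ {c₁ c₂ T : ℝ}, HasApproxTrajectoryBound h c₁ c₂ T →
      ForSmallParameters k fun ε => TrajectoryBound (F ε) c₁ c₂ T := fun hB => by
    obtain ⟨N, hN⟩ := hB.exists_trajectoryBound
    exact (hF N).mono fun ε hε => hN _ hε
  refine ⟨fun c₂ hc₂ => ?_, fun c₁ _ => ?_, fun δ _ c₁ _ c₂ hc₂ => ?_⟩
  · obtain ⟨c₁, hc₁, hB⟩ := hG.exists_hasApproxTrajectoryBound_stable hh hc₂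
    exact ⟨c₁, hc₁, key hB⟩
  · obtain ⟨c₂, hc₂, hB⟩ := hG.exists_hasApproxTrajectoryBound_bounded hh c₁
    exact ⟨c₂, hc₂, key hB⟩
  · obtain ⟨T, hT, hB⟩ := hG.exists_hasApproxTrajectoryBound_attractive hh c₁ hc₂
    exact ⟨T, hT, key hB⟩

end Transfer

/-! ### The averaging principle. -/

/-- The mean of `G(·, x)` over windows of length `T` tends to `g(x)` as `T → ∞`, uniformly in the
position of the window. -/
def HasUniformMean {m : ℕ} (G : ℝ → EuclideanSpace ℝ (Fin m) → EuclideanSpace ℝ (Fin m))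
    (g : EuclideanSpace ℝ (Fin m) → EuclideanSpace ℝ (Fin m)) : Prop :=
  ∀ x, TendstoUniformly (fun (T : ℝ) (s : ℝ) => T⁻¹ • ∫ τ in s..(s + T), G τ x)
    (fun _ => g x) atTop

section Averaging

variable {m : ℕ} {G : ℝ → EuclideanSpace ℝ (Fin m) → EuclideanSpace ℝ (Fin m)}
  {g : EuclideanSpace ℝ (Fin m) → EuclideanSpace ℝ (Fin m)}

theorem IsLipschitzField.comp_mul (hG : IsLipschitzField G) (c : ℝ) :
    IsLipschitzField fun t x => G (c * t) x :=
  ⟨fun x => (hG.continuous_time x).comp (by fun_prop), fun r hr => by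
    obtain ⟨L, hL⟩ := hG.lipschitz r hr
    exact ⟨L, fun t => hL _⟩⟩

theorem norm_integral_sub_le_of_lipschitz {L : NNReal} {r : ℝ} (hG : ∀ x, Continuous fun t => G t x)
    (hL : ∀ t, LipschitzOnWith L (G t) (Metric.closedBall 0 r)) {x y : EuclideanSpace ℝ (Fin m)}
    (hx : ‖x‖ ≤ r) (hy : ‖y‖ ≤ r) {s t : ℝ} (hst : s ≤ t) :
    ‖(∫ τ in s..t, G τ x) - ∫ τ in s..t, G τ y‖ ≤ L * ‖x - y‖ * (t - s) := by
  rw [← intervalIntegral.integral_sub ((hG x).intervalIntegrable _ _)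
    ((hG y).intervalIntegrable _ _), ← abs_of_nonneg (sub_nonneg.2 hst)]
  refine intervalIntegral.norm_integral_le_of_norm_le_const fun τ _ => ?_
  rw [← dist_eq_norm, ← dist_eq_norm]
  exact (hL τ).dist_le_mul _ (mem_closedBall_zero_iff.2 hx) _ (mem_closedBall_zero_iff.2 hy)

theorem HasUniformMean.lipschitzOnWith (hg : HasUniformMean G g) {L : NNReal} {r : ℝ}
    (hG : ∀ x, Continuous fun t => G t x)
    (hL : ∀ t, LipschitzOnWith L (G t) (Metric.closedBall 0 r)) :
    LipschitzOnWith L g (Metric.closedBall 0 r) := by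
  refine LipschitzOnWith.of_dist_le_mul fun x hx y hy => ?_
  rw [mem_closedBall_zero_iff] at hx hy
  refine le_of_tendsto (((hg x).tendsto_at 0).dist ((hg y).tendsto_at 0)) ?_
  filter_upwards [eventually_gt_atTop 0] with T hT
  rw [dist_eq_norm, dist_eq_norm, ← smul_sub, norm_smul, norm_inv, Real.norm_of_nonneg hT.le,
    inv_mul_le_iff₀ hT]
  have := norm_integral_sub_le_of_lipschitz hG hL hx hy (show (0 : ℝ) ≤ 0 + T by linarith)
  rw [zero_add, sub_zero, ← zero_add T] at this
  simpa [mul_comm] using this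

theorem HasUniformMean.isLipschitzField (hg : HasUniformMean G g) (hG : IsLipschitzField G) :
    IsLipschitzField fun _ => g :=
  ⟨fun _ => continuous_const, fun r hr => by
    obtain ⟨L, hL⟩ := hG.lipschitz r hr
    exact ⟨L, fun _ => hg.lipschitzOnWith hG.continuous_time hL⟩⟩

/-- A window of any length is the difference of windows of lengths `T + T₀` and `T₀`, both long
enough for the mean estimate. -/
theorem HasUniformMean.exists_norm_integral_sub_le (hg : HasUniformMean G g)
    (hG : IsLipschitzField G) (x : EuclideanSpace ℝ (Fin m)) {κ : ℝ} (hκ : 0 < κ) :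
    ∃ T₀ > 0, ∀ s T, 0 ≤ T →
      ‖(∫ τ in s..(s + T), G τ x) - T • g x‖ ≤ κ * (T + 2 * T₀) := by
  obtain ⟨T₀, hT₀, H⟩ := ((eventually_gt_atTop (0 : ℝ)).and
    (eventually_forall_ge_atTop.2 (Metric.tendstoUniformly_iff.1 (hg x) κ hκ))).exists
  have long : ∀ s T, T₀ ≤ T → ‖(∫ τ in s..(s + T), G τ x) - T • g x‖ ≤ κ * T := fun s T hT => by
    have hT0 : 0 < T := hT₀.trans_le hT
    have h1 := (H T hT s).le
    rw [dist_comm, dist_eq_norm] at h1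
    have e : (∫ τ in s..(s + T), G τ x) - T • g x
        = T • (T⁻¹ • (∫ τ in s..(s + T), G τ x) - g x) := by
      rw [smul_sub, smul_inv_smul₀ hT0.ne']
    rw [e, norm_smul, Real.norm_of_nonneg hT0.le, mul_comm]
    exact mul_le_mul_of_nonneg_right h1 hT0.le
  refine ⟨T₀, hT₀, fun s T hT => ?_⟩
  have hint : ∀ a b, IntervalIntegrable (fun τ => G τ x) MeasureTheory.volume a b := fun a b =>
    (hG.continuous_time x).intervalIntegrable a b
  have h1 := long s (T + T₀) (by linarith)
  have h2 := long (s + T) T₀ le_rfl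
  have e : (∫ τ in s..(s + T), G τ x) - T • g x
      = ((∫ τ in s..(s + (T + T₀)), G τ x) - (T + T₀) • g x)
        - ((∫ τ in (s + T)..(s + T + T₀), G τ x) - T₀ • g x) := by
    rw [← add_assoc s T T₀,
      ← intervalIntegral.integral_add_adjacent_intervals (hint s (s + T))
        (hint (s + T) (s + T + T₀)), add_smul]
    abel
  rw [e]
  refine (norm_sub_le _ _).trans ?_
  linarith

theorem HasUniformMean.eventually_norm_integral_sub_le (hg : HasUniformMean G g)
    (hG : IsLipschitzField G) (x : EuclideanSpace ℝ (Fin m)) {W η : ℝ} (hW : 0 < W) (hη : 0 < η) :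
    ∀ᶠ ε : ℝ in 𝓝[>] 0, ∀ s t, s ≤ t → t ≤ s + W →
      ‖(∫ σ in s..t, G (ε⁻¹ * σ) x) - (t - s) • g x‖ ≤ η := by
  -- After rescaling time the error is `κ * ((t - s) + ε * 2T₀)`; for `ε < W / (2T₀)` it is at most
  -- `κ * 2W = η`.
  obtain ⟨T₀, hT₀, H⟩ := hg.exists_norm_integral_sub_le hG x (show 0 < η / (2 * W) by positivity)
  have hpos : 0 < W / (2 * T₀) := by positivity
  filter_upwards [Ioo_mem_nhdsGT hpos] with ε hε s t hst ht
  have hε0 : 0 < ε := hε.1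
  have h1 := H (ε⁻¹ * s) (ε⁻¹ * (t - s)) (mul_nonneg (by positivity) (by linarith))
  have e : (∫ σ in s..t, G (ε⁻¹ * σ) x) - (t - s) • g x
      = ε • ((∫ τ in (ε⁻¹ * s)..(ε⁻¹ * s + ε⁻¹ * (t - s)), G τ x) - (ε⁻¹ * (t - s)) • g x) := by
    rw [intervalIntegral.integral_comp_mul_left (fun τ => G τ x) (inv_ne_zero hε0.ne'), inv_inv,
      smul_sub, smul_smul, mul_inv_cancel_left₀ hε0.ne', ← mul_add, add_sub_cancel]
  rw [e, norm_smul, Real.norm_of_nonneg hε0.le]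
  calc ε * _ ≤ ε * (η / (2 * W) * (ε⁻¹ * (t - s) + 2 * T₀)) :=
        mul_le_mul_of_nonneg_left h1 hε0.le
    _ = η / (2 * W) * ((t - s) + ε * (2 * T₀)) := by field_simp
    _ ≤ η / (2 * W) * (W + W) := by
        have := (lt_div_iff₀ (by positivity)).1 hε.2
        exact mul_le_mul_of_nonneg_left (by linarith) (by positivity)
    _ = η := by field_simp; ring

theorem HasUniformMean.eventually_forall_norm_integral_sub_le (hg : HasUniformMean G g)
    (hG : IsLipschitzField G) {r W η : ℝ} (hr : 0 < r) (hW : 0 < W) (hη : 0 < η) :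
    ∀ᶠ ε : ℝ in 𝓝[>] 0, ∀ x, ‖x‖ ≤ r → ∀ s t, s ≤ t → t ≤ s + W →
      ‖(∫ σ in s..t, G (ε⁻¹ * σ) x) - (t - s) • g x‖ ≤ η := by
  obtain ⟨L, hL⟩ := hG.lipschitz r hr
  have hgL := hg.lipschitzOnWith hG.continuous_time hL
  -- Moving `x` to a centre of the cover costs `η / 4` in each of the two terms; the centre itself
  -- costs `η / 2`.
  have hd : 0 < η / (4 * (L + 1) * W) := by positivity
  obtain ⟨S, hSr, hS, hcov⟩ :=
    (isCompact_closedBall (0 : EuclideanSpace ℝ (Fin m)) r).finite_cover_balls hd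
  have hall : ∀ᶠ ε : ℝ in 𝓝[>] 0, ∀ y ∈ S, ∀ s t, s ≤ t → t ≤ s + W →
      ‖(∫ σ in s..t, G (ε⁻¹ * σ) y) - (t - s) • g y‖ ≤ η / 2 :=
    (eventually_all_finite hS).2 fun y _ =>
      hg.eventually_norm_integral_sub_le hG y hW (by positivity)
  filter_upwards [hall] with ε hε x hx s t hst ht
  have hx' := hcov (mem_closedBall_zero_iff.2 hx)
  simp only [mem_iUnion, Metric.mem_ball, exists_prop] at hx'
  obtain ⟨y, hyS, hxy⟩ := hx'
  have hy : ‖y‖ ≤ r := mem_closedBall_zero_iff.1 (hSr hyS)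
  rw [dist_eq_norm] at hxy
  have h1 := norm_integral_sub_le_of_lipschitz (hG.comp_mul ε⁻¹).continuous_time (fun t => hL _)
    hx hy hst
  have h2 : ‖(t - s) • g x - (t - s) • g y‖ ≤ L * ‖x - y‖ * (t - s) := by
    rw [← smul_sub, norm_smul, Real.norm_of_nonneg (by linarith), mul_comm]
    have := hgL.dist_le_mul x (mem_closedBall_zero_iff.2 hx) y (mem_closedBall_zero_iff.2 hy)
    rw [dist_eq_norm, dist_eq_norm] at this
    exact mul_le_mul_of_nonneg_right this (by linarith)
  have h3 : L * ‖x - y‖ * (t - s) ≤ η / 4 := by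
    calc L * ‖x - y‖ * (t - s) ≤ (L + 1) * (η / (4 * (L + 1) * W)) * W := by
          gcongr
          · linarith
          · linarith
      _ = η / 4 := by field_simp
  have e : (∫ σ in s..t, G (ε⁻¹ * σ) x) - (t - s) • g x
      = ((∫ σ in s..t, G (ε⁻¹ * σ) x) - ∫ σ in s..t, G (ε⁻¹ * σ) y)
        + ((∫ σ in s..t, G (ε⁻¹ * σ) y) - (t - s) • g y)
        - ((t - s) • g x - (t - s) • g y) := by abel
  rw [e]
  refine (norm_sub_le _ _).trans ?_
  linarith [norm_add_le ((∫ σ in s..t, G (ε⁻¹ * σ) x) - ∫ σ in s..t, G (ε⁻¹ * σ) y)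
    ((∫ σ in s..t, G (ε⁻¹ * σ) y) - (t - s) • g y), hε y hyS s t hst ht]

/-- An error functional that is additive over adjacent intervals and small on short intervals is
small on long ones. -/
theorem norm_le_of_additive_of_short {E : Type*} [SeminormedAddCommGroup E] {e : ℝ → ℝ → E}
    {s t d κ γ : ℝ} (hd : 0 ≤ d)
    (hadd : ∀ u v w, s ≤ u → u ≤ v → v ≤ w → w ≤ t → e u w = e u v + e v w)
    (hshort : ∀ u v, s ≤ u → u ≤ v → v ≤ t → v - u ≤ d → ‖e u v‖ ≤ κ + γ * (v - u)) (hκ : 0 ≤ κ)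
    (n : ℕ) : ∀ u v, s ≤ u → u ≤ v → v ≤ t → v - u ≤ (n + 1) * d →
      ‖e u v‖ ≤ (n + 1) * κ + γ * (v - u) := by
  induction n with
  | zero => simpa using hshort
  | succ n ih =>
    intro u v hu huv hv hvu
    push_cast at hvu ⊢
    rcases le_total (v - u) d with h | h
    · nlinarith [hshort u v hu huv hv h, mul_nonneg (Nat.cast_nonneg (α := ℝ) n) hκ]
    · rw [hadd u (u + d) v hu (by linarith) (by linarith) hv]
      refine (norm_add_le _ _).trans ?_
      have h1 := hshort u (u + d) hu (by linarith) (by linarith) (by linarith)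
      have h2 := ih (u + d) v (by linarith) (by linarith) hv (by linarith)
      linarith

/-- One step of the averaging estimate: on a window where the solution oscillates by at most `ρ`,
its increment is close to that of the averaged equation frozen at the left end point. -/
theorem IsSolutionOn.norm_sub_sub_smul_le {F : ℝ → EuclideanSpace ℝ (Fin m) → EuclideanSpace ℝ (Fin m)}
    (hF : IsLipschitzField F) {L : NNReal} {r κ ρ : ℝ}
    (hL : ∀ t, LipschitzOnWith L (F t) (Metric.closedBall 0 r))
    {x : ℝ → EuclideanSpace ℝ (Fin m)} {u v : ℝ} (huv : u ≤ v) (hx : IsSolutionOn F x (Icc u v))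
    (hr : ∀ σ ∈ Icc u v, ‖x σ‖ ≤ r) (hρ : ∀ σ ∈ Icc u v, ‖x σ - x u‖ ≤ ρ)
    (hκ : ‖(∫ σ in u..v, F σ (x u)) - (v - u) • g (x u)‖ ≤ κ) :
    ‖x v - x u - (v - u) • g (x u)‖ ≤ κ + L * ρ * (v - u) := by
  rw [hx.sub_eq_integral hF.continuous huv]
  have hc : ContinuousOn (fun σ => F σ (x σ)) (uIcc u v) := by
    rw [uIcc_of_le huv]
    exact hF.continuous.comp_continuousOn (f := fun σ => (σ, x σ))
      (continuousOn_id.prodMk hx.continuousOn)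
  have h1 : ‖(∫ σ in u..v, F σ (x σ)) - ∫ σ in u..v, F σ (x u)‖ ≤ L * ρ * (v - u) := by
    rw [← intervalIntegral.integral_sub hc.intervalIntegrable
      ((hF.continuous_time _).intervalIntegrable _ _), ← abs_of_nonneg (sub_nonneg.2 huv)]
    refine intervalIntegral.norm_integral_le_of_norm_le_const fun σ hσ => ?_
    rw [uIoc_of_le huv] at hσ
    have hσ' : σ ∈ Icc u v := ⟨hσ.1.le, hσ.2⟩
    rw [← dist_eq_norm]
    refine ((hL σ).dist_le_mul _ (mem_closedBall_zero_iff.2 (hr σ hσ')) _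
      (mem_closedBall_zero_iff.2 (hr u (left_mem_Icc.2 huv)))).trans ?_
    rw [dist_eq_norm]
    exact mul_le_mul_of_nonneg_left (hρ σ hσ') L.2
  have e : (∫ σ in u..v, F σ (x σ)) - (v - u) • g (x u)
      = ((∫ σ in u..v, F σ (x u)) - (v - u) • g (x u))
        + ((∫ σ in u..v, F σ (x σ)) - ∫ σ in u..v, F σ (x u)) := by abel
  rw [e]
  exact (norm_add_le _ _).trans (add_le_add hκ h1)

/-- Freezing error of the averaged field, to be subtracted from that of the solution so that the
common term `(v - u) • g (x u)` cancels. -/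
theorem norm_integral_sub_smul_le {L : NNReal} {r ρ : ℝ}
    (hL : LipschitzOnWith L g (Metric.closedBall 0 r))
    {x : ℝ → EuclideanSpace ℝ (Fin m)} {u v : ℝ} (huv : u ≤ v) (hx : ContinuousOn x (Icc u v))
    (hr : ∀ σ ∈ Icc u v, ‖x σ‖ ≤ r) (hρ : ∀ σ ∈ Icc u v, ‖x σ - x u‖ ≤ ρ) :
    ‖(∫ σ in u..v, g (x σ)) - (v - u) • g (x u)‖ ≤ L * ρ * (v - u) := by
  have hmem : ∀ σ ∈ Icc u v, x σ ∈ Metric.closedBall (0 : EuclideanSpace ℝ (Fin m)) r :=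
    fun σ hσ => mem_closedBall_zero_iff.2 (hr σ hσ)
  have hc : ContinuousOn (fun σ => g (x σ)) (uIcc u v) := by
    rw [uIcc_of_le huv]
    exact hL.continuousOn.comp hx hmem
  rw [← intervalIntegral.integral_const, ← intervalIntegral.integral_sub hc.intervalIntegrable
    intervalIntegrable_const, ← abs_of_nonneg (sub_nonneg.2 huv)]
  refine intervalIntegral.norm_integral_le_of_norm_le_const fun σ hσ => ?_
  rw [uIoc_of_le huv] at hσ
  have hσ' : σ ∈ Icc u v := ⟨hσ.1.le, hσ.2⟩
  rw [← dist_eq_norm]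
  refine (hL.dist_le_mul _ (hmem σ hσ') _ (hmem u (left_mem_Icc.2 huv))).trans ?_
  rw [dist_eq_norm]
  exact mul_le_mul_of_nonneg_left (hρ σ hσ') L.2

/-- The averaging principle: for small `ε`, solutions of `ẋ = G(t / ε, x)` satisfy, while in a
ball, the integral equation of the averaged system up to a small error. -/
theorem HasUniformMean.eventually_norm_sub_sub_integral_le (hg : HasUniformMean G g)
    (hG : IsLipschitzField G) {r W η : ℝ} (hr : 0 < r) (hW : 0 < W) (hη : 0 < η) :
    ∀ᶠ ε : ℝ in 𝓝[>] 0, ∀ s t, s ≤ t → t ≤ s + W → ∀ x : ℝ → EuclideanSpace ℝ (Fin m),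
      IsSolutionOn (fun t x => G (ε⁻¹ * t) x) x (Icc s t) → (∀ u ∈ Icc s t, ‖x u‖ ≤ r) →
      ‖x t - x s - ∫ u in s..t, g (x u)‖ ≤ η := by
  obtain ⟨L, hL⟩ := hG.lipschitz r hr
  have hgL := hg.lipschitzOnWith hG.continuous_time hL
  obtain ⟨M, hM⟩ := (isCompact_closedBall (0 : EuclideanSpace ℝ (Fin m)) r).exists_bound_of_continuousOn
    hgL.continuousOn
  have hM0 : 0 ≤ M := (norm_nonneg _).trans (hM 0 (by simp [hr.le]))
  have hL0 : (0 : ℝ) ≤ L := L.2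
  set C : ℝ := M + L * (2 * r) with hC
  have hC0 : 0 ≤ C := by positivity
  -- Over `n + 1` pieces of length `d` the total error is at most `(n + 1 + 2LW) * κ + 2LCWd`; `n`
  -- makes the second term at most `η / 2`, then `κ` makes the first equal to `η / 2`.
  obtain ⟨n, hn⟩ := exists_nat_ge (4 * L * C * W * W / η)
  set d : ℝ := W / (n + 1) with hd
  have hd0 : 0 < d := by positivity
  set κ : ℝ := η / (2 * (n + 1 + 2 * L * W)) with hκ
  have hκ0 : 0 < κ := by positivity
  filter_upwards [hg.eventually_forall_norm_integral_sub_le hG hr hW hκ0] with ε hε s t hst ht x hx hxr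
  have hF := hG.comp_mul ε⁻¹
  have sub : ∀ {u v}, s ≤ u → v ≤ t → Icc u v ⊆ Icc s t := fun hu hv => Icc_subset_Icc hu hv
  have frozen : ∀ u v, s ≤ u → u ≤ v → v ≤ t → ∀ ρ, (∀ σ ∈ Icc u v, ‖x σ - x u‖ ≤ ρ) →
      ‖x v - x u - (v - u) • g (x u)‖ ≤ κ + L * ρ * (v - u) := fun u v hu huv hv ρ hρ =>
    (hx.mono (sub hu hv)).norm_sub_sub_smul_le hF (fun t => hL _) huv
      (fun σ hσ => hxr σ (sub hu hv hσ)) hρ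
      (hε _ (hxr u (sub hu hv (left_mem_Icc.2 huv))) u v huv (by linarith))
  -- `G` need not be bounded in time, so the speed of `x` has no direct bound. The crude oscillation
  -- bound `2r` in the frozen estimate yields the finer one `κ + C * d`.
  have osc : ∀ u v, s ≤ u → u ≤ v → v ≤ t → v - u ≤ d → ‖x v - x u‖ ≤ κ + C * d :=
    fun u v hu huv hv hvu => by
      have hxu := hxr u ⟨hu, huv.trans hv⟩
      have h1 := frozen u v hu huv hv (2 * r) fun σ hσ => by
        linarith [norm_sub_le (x σ) (x u), hxr σ (sub hu hv hσ)]
      have h2 : ‖(v - u) • g (x u)‖ ≤ (v - u) * M := by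
        rw [norm_smul, Real.norm_of_nonneg (by linarith)]
        exact mul_le_mul_of_nonneg_left (hM _ (mem_closedBall_zero_iff.2 hxu)) (by linarith)
      have h3 := norm_add_le (x v - x u - (v - u) • g (x u)) ((v - u) • g (x u))
      rw [sub_add_cancel] at h3
      have h4 : C * (v - u) ≤ C * d := mul_le_mul_of_nonneg_left hvu hC0
      rw [hC] at h4 ⊢
      linarith
  have hint : ∀ u v, s ≤ u → u ≤ v → v ≤ t →
      IntervalIntegrable (fun σ => g (x σ)) MeasureTheory.volume u v := fun u v hu huv hv => by
    refine ContinuousOn.intervalIntegrable ?_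
    rw [uIcc_of_le huv]
    exact hgL.continuousOn.comp (hx.continuousOn.mono (sub hu hv)) fun σ hσ =>
      mem_closedBall_zero_iff.2 (hxr σ (sub hu hv hσ))
  have key := norm_le_of_additive_of_short (s := s) (t := t) (d := d) (κ := κ)
    (γ := 2 * L * (κ + C * d)) (e := fun u v => x v - x u - ∫ σ in u..v, g (x σ)) hd0.le
    (fun u v w hu huv hvw hw => by
      rw [← intervalIntegral.integral_add_adjacent_intervals (hint u v hu huv (hvw.trans hw))
        (hint v w (hu.trans huv) hvw hw)]
      abel)
    (fun u v hu huv hv hvu => by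
      have hosc : ∀ σ ∈ Icc u v, ‖x σ - x u‖ ≤ κ + C * d := fun σ hσ =>
        osc u σ hu hσ.1 (hσ.2.trans hv) (by linarith [hσ.2])
      have h1 := frozen u v hu huv hv _ hosc
      have h2 := norm_integral_sub_smul_le hgL huv (hx.continuousOn.mono (sub hu hv))
        (fun σ hσ => hxr σ (sub hu hv hσ)) hosc
      have e : x v - x u - ∫ σ in u..v, g (x σ) = (x v - x u - (v - u) • g (x u))
          - ((∫ σ in u..v, g (x σ)) - (v - u) • g (x u)) := by abel
      rw [e]
      refine (norm_sub_le _ _).trans ?_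
      linarith)
    hκ0.le n s t le_rfl hst le_rfl (by rw [hd, mul_div_cancel₀ _ (by positivity)]; linarith)
  refine key.trans ?_
  have h1 : 2 * L * (κ + C * d) * (t - s) ≤ 2 * L * (κ + C * d) * W :=
    mul_le_mul_of_nonneg_left (by linarith) (by positivity)
  have h2 : (n + 1 + 2 * L * W) * κ = η / 2 := by rw [hκ]; field_simp
  have h3 : 2 * L * C * W * d ≤ η / 2 := by
    rw [div_le_iff₀ hη] at hn
    rw [hd, ← mul_div_assoc, div_le_iff₀ (by positivity)]
    linarith
  linarith

end Averaging

/-! ### Closeness of the average and model-free systems to `h`. -/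

section ModelFree

variable {m : ℕ} {f : ℝ → EuclideanSpace ℝ (Fin m) → ℝ → EuclideanSpace ℝ (Fin m)}
  {fbar : EuclideanSpace ℝ (Fin m) → ℝ → EuclideanSpace ℝ (Fin m)}
  {h : EuclideanSpace ℝ (Fin m) → EuclideanSpace ℝ (Fin m)}

theorem IsRegularField.isLipschitzField (hf : IsRegularField f) {a : ℝ} (ha : 0 < a) :
    IsLipschitzField fun τ x => f τ x a :=
  ⟨hf.continuous_time a ha, hf.lipschitz a ha⟩

theorem IsAverageOf.hasUniformMean (havg : IsAverageOf f fbar) {a : ℝ} (ha : 0 < a) :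
    HasUniformMean (fun τ x => f τ x a) fun x => fbar x a :=
  havg a ha

theorem IsAverageOf.isLipschitzField (havg : IsAverageOf f fbar) (hf : IsRegularField f) {a : ℝ}
    (ha : 0 < a) : IsLipschitzField fun _ x => fbar x a :=
  (havg.hasUniformMean ha).isLipschitzField (hf.isLipschitzField ha)

theorem IsAverageOf.continuous (havg : IsAverageOf f fbar) (hf : IsRegularField f) {a : ℝ}
    (ha : 0 < a) : Continuous fun x => fbar x a :=
  (havg.isLipschitzField hf ha).continuous.comp (Continuous.prodMk_right (0 : ℝ))

theorem IsModelBasedLimit.continuous (hlim : IsModelBasedLimit fbar h)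
    (havg : IsAverageOf f fbar) (hf : IsRegularField f) : Continuous h :=
  TendstoLocallyUniformly.continuous hlim
    ((eventually_mem_nhdsWithin (s := Ioi (0 : ℝ))).mono fun _ ha => havg.continuous hf ha).frequently

theorem IsModelBasedLimit.exists_norm_integral_sub_le (hlim : IsModelBasedLimit fbar h)
    (havg : IsAverageOf f fbar) (hf : IsRegularField f) (N : ℕ) :
    ∃ a' > 0, ∀ a ∈ Ioo 0 a', ∀ s t : ℝ, s ≤ t → t ≤ s + N →
      ∀ x : ℝ → EuclideanSpace ℝ (Fin m), ContinuousOn x (Icc s t) →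
      (∀ u ∈ Icc s t, ‖x u‖ ≤ N) →
      ‖(∫ u in s..t, fbar (x u) a) - ∫ u in s..t, h (x u)‖ ≤ 1 / (2 * (N + 1)) := by
  have hunif := tendstoLocallyUniformly_iff_forall_isCompact.1 hlim _
    (isCompact_closedBall (0 : EuclideanSpace ℝ (Fin m)) N)
  -- Integrated over a window of length at most `N`, this uses half of the budget `1 / (N + 1)`;
  -- averaging may spend the other half.
  have hν : (0 : ℝ) < 1 / (2 * (N + 1) * (N + 1)) := by positivity
  obtain ⟨a', ha', H⟩ := mem_nhdsGT_iff_exists_Ioo_subset.1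
    (Metric.tendstoUniformlyOn_iff.1 hunif _ hν)
  refine ⟨a', ha', fun a ha s t hst ht x hx hxN => ?_⟩
  have hh := hlim.continuous havg hf
  have hfb := havg.continuous hf ha.1
  have hx' : ContinuousOn x (uIcc s t) := by rwa [uIcc_of_le hst]
  have h1 : IntervalIntegrable (fun u => fbar (x u) a) MeasureTheory.volume s t :=
    (hfb.comp_continuousOn hx').intervalIntegrable
  have h2 : IntervalIntegrable (fun u => h (x u)) MeasureTheory.volume s t :=
    (hh.comp_continuousOn hx').intervalIntegrable
  rw [← intervalIntegral.integral_sub h1 h2]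
  refine (intervalIntegral.norm_integral_le_of_norm_le_const
    (C := 1 / (2 * ((N : ℝ) + 1) * (N + 1))) fun u hu => ?_).trans ?_
  · rw [uIoc_of_le hst] at hu
    rw [← dist_eq_norm, dist_comm]
    exact (H ha (x u) (mem_closedBall_zero_iff.2 (hxN u ⟨hu.1.le, hu.2⟩))).le
  · rw [abs_of_nonneg (sub_nonneg.2 hst)]
    calc 1 / (2 * ((N : ℝ) + 1) * (N + 1)) * (t - s)
        ≤ 1 / (2 * ((N : ℝ) + 1) * (N + 1)) * (N + 1) :=
          mul_le_mul_of_nonneg_left (by linarith) hν.le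
      _ = 1 / (2 * (N + 1)) := by field_simp

theorem approximatesField_averageSystem (hf : IsRegularField f) (havg : IsAverageOf f fbar)
    (hlim : IsModelBasedLimit fbar h) (N : ℕ) :
    ForSmallParameters 1 fun ε => ApproximatesField h N (averageSystem fbar ε) := by
  obtain ⟨a', ha', H⟩ := hlim.exists_norm_integral_sub_le havg hf N
  refine ⟨a', ha', fun a ha => ⟨havg.isLipschitzField hf ha.1, fun s t hst ht x hx hxN => ?_⟩⟩
  have hx' : IsSolutionOn (fun _ x => fbar x a) x (Icc s t) := hx
  rw [hx'.sub_eq_integral (havg.isLipschitzField hf ha.1).continuous hst]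
  refine (H a ha s t hst ht x hx.continuousOn hxN).trans ?_
  exact one_div_le_one_div_of_le (by positivity) (by linarith [(N.cast_nonneg : (0 : ℝ) ≤ N)])

theorem approximatesField_modelFreeSystem (hf : IsRegularField f) (havg : IsAverageOf f fbar)
    (hlim : IsModelBasedLimit fbar h) (N : ℕ) :
    ForSmallParameters 2 fun ε => ApproximatesField h N (modelFreeSystem f ε) := by
  obtain ⟨a', ha', H⟩ := hlim.exists_norm_integral_sub_le havg hf N
  refine ⟨a', ha', fun a ha => ?_⟩
  -- The threshold for `ω⁻¹` depends on `a`, as the nested quantifiers allow. Radius and window are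
  -- `N + 1` to be positive also for `N = 0`.
  obtain ⟨ε', hε', K⟩ := mem_nhdsGT_iff_exists_Ioo_subset.1
    ((havg.hasUniformMean ha.1).eventually_norm_sub_sub_integral_le (hf.isLipschitzField ha.1)
      (show (0 : ℝ) < N + 1 by positivity) (show (0 : ℝ) < N + 1 by positivity)
      (show (0 : ℝ) < 1 / (2 * (N + 1)) by positivity))
  refine ⟨ε', hε', fun ε hε => ⟨(hf.isLipschitzField ha.1).comp_mul ε⁻¹,
    fun s t hst ht x hx hxN => ?_⟩⟩
  have h1 := K hε s t hst (by linarith) x hx fun u hu => (hxN u hu).trans (by linarith)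
  have h2 := H a ha s t hst ht x hx.continuousOn hxN
  rw [← sub_add_sub_cancel _ (∫ u in s..t, fbar (x u) a)]
  refine (norm_add_le _ _).trans ((add_le_add h1 h2).trans_eq ?_)
  field_simp
  norm_num

end ModelFree

theorem theorem1 (m : ℕ)
    (f : ℝ → EuclideanSpace ℝ (Fin m) → ℝ → EuclideanSpace ℝ (Fin m))
    (fbar : EuclideanSpace ℝ (Fin m) → ℝ → EuclideanSpace ℝ (Fin m))
    (h : EuclideanSpace ℝ (Fin m) → EuclideanSpace ℝ (Fin m))
    (hf : IsRegularField f)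
    (havg : IsAverageOf f fbar)
    (hlim : IsModelBasedLimit fbar h)
    (hGAS : IsGAS h) :
    IsSGPUAS (averageSystem fbar) ∧ IsSGPUAS (modelFreeSystem f) :=
  have hh := hlim.continuous havg hf
  ⟨hGAS.isSGPUAS hh (approximatesField_averageSystem hf havg hlim),
    hGAS.isSGPUAS hh (approximatesField_modelFreeSystem hf havg hlim)⟩
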